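/- Let $\mathbb D$ be the open unit disk and let $\mathcal A$ be the class of analytic functions $f$ on $\mathbb D$ with $f(0)=0$, $f'(0)=1$; let $\mathcal S\subset\mathcal A$ be the subclass of univalent functions. Let $\mathcal P$ be the class of analytic $p$ on $\mathbb D$ with $p(0)=1$ and $\operatorname{Re}p>0$, let $k(z)=z/(1-z)^2$, and let $$\Pi_2=\{f\in\mathcal A:\ |f/g-1|<1 \text{ on } \mathbb D \text{ for some } g\in\mathcal A \text{ with } g/k\in\mathcal P\}$$ (quotients are extended by the value $1$ at $0$). For analytic $\varphi$ on $\mathbb D$ let $\mathcal S^*(\varphi)$ be the class of $f\in\mathcal A$ with $zf'(z)/f(z)\prec\varphi(z)$, where $F\prec\varphi$ means $F=\varphi\circ w$ for some analytic $w:\mathbb D\to\mathbb D$ with $w(0)=0$. Write - $\mathcal S^*(\alpha)$ for $\varphi(z)=\dfrac{1+(1-2\alpha)z}{1-z}$, $0\le\alpha<1$; - $\mathcal S^*_L$ for $\varphi(z)=\sqrt{1+z}$; - $\mathcal S_P$ for $\varphi(z)=1+\dfrac{2}{\pi^2}\Bigl(\log\dfrac{1+\sqrt z}{1-\sqrt z}\Bigr)^2$;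 - $\mathcal S^*_e$ for $\varphi(z)=e^z$; - $\mathcal S^*_c$ for $\varphi(z)=1+\frac43z+\frac23z^2$; - $\mathcal S^*_{\sin}$ for $\varphi(z)=1+\sin z$; - $\mathcal S^*_{\mathrm{moon}}$ for $\varphi(z)=z+\sqrt{1+z^2}$; - $\mathcal S^*_R$ for $\varphi(z)=1+\dfrac{\kappa z+z^2}{\kappa^2-\kappa z}$, $\kappa=\sqrt2+1$. For a class $\mathcal G\subset\mathcal A$, the $\mathcal G$ radius of $\Pi_2$ is the largest number $R\in[0,1]$ such that $r^{-1}f(rz)\in\mathcal G$ for all $0<r<R$ and all $f\in\Pi_2$. Then the following hold for $\Pi_2$: 1. The $\mathcal S^*(\alpha)$ radius is $\dfrac{2(1-\alpha)}{5+\sqrt{4\alpha^2-4\alpha+25}}$ for $0\le\alpha<1$. 2. The $\mathcal S^*_L$ radius is at least $\dfrac{\sqrt{4\sqrt2+25}-5}{2(\sqrt2+2)}$. 3. The $\mathcal S_P$ radius is $5-2\sqrt6$. 4. The $\mathcal S^*_e$ radius is $\dfrac{2(e-1)}{5e+\sqrt{25e^2-4e+4}}$. 5. The $\mathcal S^*_c$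 radius is $\dfrac{15-\sqrt{217}}2$. 6. The $\mathcal S^*_{\sin}$ radius is at least $\dfrac{\sqrt{25+4(3+\sin1)\sin1}-5}{2(3+\sin1)}$. 7. The $\mathcal S^*_{\mathrm{moon}}$ radius is $\dfrac{5-\sqrt{41-12\sqrt2}}{2(\sqrt2-1)}$. 8. The $\mathcal S^*_R$ radius is $\dfrac{5-\sqrt{81-40\sqrt2}}{4(\sqrt2-1)}$. Moreover, the radius of starlikeness ($\mathcal S^*(0)$) and the radius of univalence ($\mathcal S$) of $\Pi_2$ are both equal to $1/5$. All radii in 1, 3, 4, 5, 7, 8, and the radii of starlikeness and of univalence, are sharp for the function $f_3(z)=\dfrac{z(1+z)^2}{(1-z)^3}\in\Pi_2$: if $R$ is the radius in question for the class $\mathcal G$ and $R<r\le1$, then $r^{-1}f_3(rz)\notin\mathcal G$. -/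

import Mathlib

open Metric

/-- The quotient `h₁ / h₂` of two functions having a simple zero with equal leading coefficient at
the origin, with its removable singularity at `0` filled in by the value `1`. -/
noncomputable def quot1 (h₁ h₂ : ℂ → ℂ) (z : ℂ) : ℂ :=
  if z = 0 then 1 else h₁ z / h₂ z

/-- The class `𝒜` of analytic functions on the open unit disk with `f 0 = 0` and `f' 0 = 1`
(the values outside the disk play no role). -/
def ClassA : Set (ℂ → ℂ) :=
  {f | DifferentiableOn ℂ f (ball 0 1) ∧ f 0 = 0 ∧ deriv f 0 = 1}

/-- The class `𝒮` of univalent functions in `𝒜`. -/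
def ClassS : Set (ℂ → ℂ) :=
  {f | f ∈ ClassA ∧ Set.InjOn f (ball 0 1)}

/-- The class `𝒫` of analytic functions with positive real part on the unit disk and `p 0 = 1`. -/
def ClassP : Set (ℂ → ℂ) :=
  {p | DifferentiableOn ℂ p (ball 0 1) ∧ p 0 = 1 ∧ ∀ z ∈ ball (0 : ℂ) 1, 0 < (p z).re}

/-- The Koebe function `k(z) = z / (1 - z)²`. -/
noncomputable def koebe (z : ℂ) : ℂ := z / (1 - z) ^ 2

/-- The class `Π₂`: functions `f ∈ 𝒜` with `|f/g - 1| < 1` on the unit disk for some `g ∈ 𝒜`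
with `g/k ∈ 𝒫`. -/
def ClassPi2 : Set (ℂ → ℂ) :=
  {f | f ∈ ClassA ∧ ∃ g ∈ ClassA, quot1 g koebe ∈ ClassP ∧
    ∀ z ∈ ball (0 : ℂ) 1, ‖quot1 f g z - 1‖ < 1}

/-- Subordination `F ≺ G` on the unit disk: `F = G ∘ w` for an analytic self-map `w` of the disk
with `w 0 = 0`. -/
def Subordinate (F G : ℂ → ℂ) : Prop :=
  ∃ w : ℂ → ℂ, DifferentiableOn ℂ w (ball 0 1) ∧ w 0 = 0 ∧
    (∀ z ∈ ball (0 : ℂ) 1, w z ∈ ball (0 : ℂ) 1) ∧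
    ∀ z ∈ ball (0 : ℂ) 1, F z = G (w z)

/-- The class `𝒮*(φ)` of all `f ∈ 𝒜` with `z f'(z) / f(z) ≺ φ(z)`; `f` has no zero in the
punctured disk, so that the quotient is analytic. -/
def StarClass (φ : ℂ → ℂ) : Set (ℂ → ℂ) :=
  {f | f ∈ ClassA ∧ (∀ z ∈ ball (0 : ℂ) 1, z ≠ 0 → f z ≠ 0) ∧
    Subordinate (quot1 (fun z => z * deriv f z) f) φ}

/-- `φ` for starlike functions of order `α`. -/
noncomputable def phiOrder (α : ℝ) (z : ℂ) : ℂ := (1 + (1 - 2 * (α : ℂ)) * z) / (1 - z)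

/-- `φ` for the class `𝒮_P` of parabolic starlike functions (principal branches). -/
noncomputable def phiP (z : ℂ) : ℂ :=
  1 + 2 / (Real.pi : ℂ) ^ 2 *
    Complex.log ((1 + z ^ (1 / 2 : ℂ)) / (1 - z ^ (1 / 2 : ℂ))) ^ 2

/-- `φ` for the class `𝒮*_L` (principal branch of the square root). -/
noncomputable def phiL (z : ℂ) : ℂ := (1 + z) ^ (1 / 2 : ℂ)

/-- `φ` for the class `𝒮*_e`. -/
noncomputable def phiE (z : ℂ) : ℂ := Complex.exp z

/-- `φ` for the class `𝒮*_c`. -/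
noncomputable def phiC (z : ℂ) : ℂ := 1 + 4 / 3 * z + 2 / 3 * z ^ 2

/-- `φ` for the class `𝒮*_sin`. -/
noncomputable def phiSin (z : ℂ) : ℂ := 1 + Complex.sin z

/-- `φ` for the class `𝒮*_☾` (principal branch of the square root). -/
noncomputable def phiMoon (z : ℂ) : ℂ := z + (1 + z ^ 2) ^ (1 / 2 : ℂ)

/-- `φ` for the class `𝒮*_R`, with `k = √2 + 1`. -/
noncomputable def phiR (z : ℂ) : ℂ :=
  let k : ℂ := ((√2 + 1 : ℝ) : ℂ)
  1 + (k * z + z ^ 2) / (k ^ 2 - k * z)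

/-- The function `z ↦ r⁻¹ f(r z)`. -/
noncomputable def dilate (r : ℝ) (f : ℂ → ℂ) (z : ℂ) : ℂ := (r : ℂ)⁻¹ * f (r * z)

/-- `IsRadius 𝒢 ℱ R`: the `𝒢` radius of `ℱ` is `R`, that is, `R` is the largest number such that
`r⁻¹ f(r z)` belongs to `𝒢` for all `0 < r < R` and all `f ∈ ℱ`. The functions live on the unit
disk, so only `R ≤ 1` makes sense. -/
def IsRadius (𝒢 ℱ : Set (ℂ → ℂ)) (R : ℝ) : Prop :=
  IsGreatest {ρ : ℝ | 0 ≤ ρ ∧ ρ ≤ 1 ∧ ∀ f ∈ ℱ, ∀ r : ℝ, 0 < r → r < ρ → dilate r f ∈ 𝒢} R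

/-- The `𝒢` radius of `ℱ` is `R`, and it is sharp for the member `f₀` of `ℱ`: no dilation
`r⁻¹ f₀(r z)` with `R < r ≤ 1` belongs to `𝒢`. -/
def IsSharpRadius (𝒢 ℱ : Set (ℂ → ℂ)) (f₀ : ℂ → ℂ) (R : ℝ) : Prop :=
  IsRadius 𝒢 ℱ R ∧ f₀ ∈ ℱ ∧ ∀ r : ℝ, R < r → r ≤ 1 → dilate r f₀ ∉ 𝒢

/-- The extremal function `f₃(z) = z (1 + z)² / (1 - z)³`. -/
noncomputable def f3 (z : ℂ) : ℂ := z * (1 + z) ^ 2 / (1 - z) ^ 3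

open scoped ComplexConjugate

/-! ### Schwarz–Pick estimates -/

/-! Write f = k·p·h with p = g/k and h = f/g, so that zf'/f = zk'/k + zp'/p + zh'/h. On |z| = r the
first term is (1+z)/(1-z), on the circle with centre c = (1+r²)/(1-r²) and radius 2r/(1-r²). By
Schwarz–Pick the other two terms are at most 2r/(1-r²) and r(1+r)/(1-r²) in modulus. Hence zf'/f
lies in the closed disk about c of radius (5r+r²)/(1-r²) (`norm_starQuot_sub_center_le`). Its left
end is (1-5r)/(1-r²), which `f3` attains at z = -r (`starQuot_f3_neg`).

For the sharp subordination classes let m be the left end of the real trace of φ(𝔻). The radius R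
solves (1-5R)/(1-R²) = m. Below R all the disks lie in the single disk centred at √2 that passes
through m. On that disk φ has an explicit analytic right inverse with values in 𝔻, which supplies
the subordinating map. Just beyond R, `f3` takes real values slightly less than m, which φ omits.
`isSharpRadius_StarClass` packages both halves.

For the lemniscate and the sine the binding constraint is the right end (1+5r+2r²)/(1-r²), and disks
about 1 are used. At z = r the function `f3` only reaches (1+5r)/(1-r²), so this estimate yields a
lower bound.

Starlike functions are univalent, so the univalence radius is at least 1/5; beyond 1/5 the function
`f3` repeats values on the negative axis. -/

theorem Complex.one_sub_conj_mul_ne_zero {a b : ℂ} (ha : ‖a‖ < 1) (hb : ‖b‖ < 1) :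
    1 - conj a * b ≠ 0 := by
  intro h
  have h1 : conj a * b = 1 := (sub_eq_zero.mp h).symm
  have h2 : ‖a‖ * ‖b‖ = 1 := by
    rw [← Complex.norm_conj a, ← norm_mul, h1, norm_one]
  nlinarith [norm_nonneg a, norm_nonneg b]

/-- This rests on |1 - āb|² - |b - a|² = (1 - |a|²)(1 - |b|²). -/
theorem Complex.norm_sub_div_one_sub_conj_mul_lt_one {a b : ℂ} (ha : ‖a‖ < 1) (hb : ‖b‖ < 1) :
    ‖(b - a) / (1 - conj a * b)‖ < 1 := by
  rw [norm_div, div_lt_one (norm_pos_iff.mpr (Complex.one_sub_conj_mul_ne_zero ha hb))]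
  refine lt_of_pow_lt_pow_left₀ 2 (norm_nonneg _) ?_
  have h1 : ‖a‖ ^ 2 < 1 := by nlinarith [norm_nonneg a]
  have h2 : ‖b‖ ^ 2 < 1 := by nlinarith [norm_nonneg b]
  rw [Complex.sq_norm, Complex.normSq_apply] at *
  rw [Complex.sq_norm, Complex.normSq_apply]
  simp only [Complex.sub_re, Complex.sub_im, Complex.mul_re, Complex.mul_im, Complex.conj_re,
    Complex.conj_im, Complex.one_re, Complex.one_im]
  nlinarith [mul_pos (sub_pos.mpr h1) (sub_pos.mpr h2)]

/-- The infinitesimal **Schwarz–Pick** inequality for self-maps of the unit disk. -/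
theorem Complex.norm_deriv_mul_le_of_mapsTo_unit_ball {w : ℂ → ℂ}
    (hd : DifferentiableOn ℂ w (ball 0 1)) (hm : Set.MapsTo w (ball 0 1) (ball 0 1))
    {z : ℂ} (hz : z ∈ ball (0 : ℂ) 1) :
    ‖deriv w z‖ * (1 - ‖z‖ ^ 2) ≤ 1 - ‖w z‖ ^ 2 := by
  have hz1 : ‖z‖ < 1 := by simpa using hz
  have hw1 : ‖w z‖ < 1 := by simpa using hm hz
  have hz2 : 0 < 1 - ‖z‖ ^ 2 := by nlinarith [norm_nonneg z]
  have hw2 : 0 < 1 - ‖w z‖ ^ 2 := by nlinarith [norm_nonneg (w z)]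
  have hnz : ‖-z‖ < 1 := by simpa using hz1
  -- Disk automorphisms: A moves 0 to z and B moves w(z) to 0, so the Schwarz lemma applies to B ∘ w
  -- ∘ A at the origin.
  set A : ℂ → ℂ := fun ζ => (ζ - -z) / (1 - conj (-z) * ζ) with hA
  set B : ℂ → ℂ := fun ζ => (ζ - w z) / (1 - conj (w z) * ζ) with hB
  have hAm : Set.MapsTo A (ball 0 1) (ball 0 1) := by
    intro ζ hζ
    have : ‖ζ‖ < 1 := by simpa using hζ
    simpa [hA] using Complex.norm_sub_div_one_sub_conj_mul_lt_one hnz this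
  have hBm : Set.MapsTo B (ball 0 1) (ball 0 1) := by
    intro ζ hζ
    have : ‖ζ‖ < 1 := by simpa using hζ
    simpa [hB] using Complex.norm_sub_div_one_sub_conj_mul_lt_one hw1 this
  have hAd : DifferentiableOn ℂ A (ball 0 1) := by
    intro ζ hζ
    have : ‖ζ‖ < 1 := by simpa using hζ
    have := Complex.one_sub_conj_mul_ne_zero hnz this
    exact ((by fun_prop : DifferentiableAt ℂ (fun ζ => ζ - -z) ζ).div (by fun_prop)
      this).differentiableWithinAt
  have hBd : DifferentiableOn ℂ B (ball 0 1) := by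
    intro ζ hζ
    have : ‖ζ‖ < 1 := by simpa using hζ
    have := Complex.one_sub_conj_mul_ne_zero hw1 this
    exact ((by fun_prop : DifferentiableAt ℂ (fun ζ => ζ - w z) ζ).div (by fun_prop)
      this).differentiableWithinAt
  have hA0 : A 0 = z := by simp [hA]
  have hBw : B (w z) = 0 := by simp [hB]
  have hAder : HasDerivAt A ((1 - ‖z‖ ^ 2 : ℝ) : ℂ) 0 := by
    have h := ((hasDerivAt_id (0 : ℂ)).sub_const (-z)).div
      (((hasDerivAt_id (0 : ℂ)).const_mul (conj (-z))).const_sub 1) (by simp)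
    refine HasDerivAt.congr_deriv (f := A) h ?_
    have := Complex.mul_conj' z
    simp only [map_neg]
    push_cast
    rw [← this]
    simp [mul_comm]
  have hBder : HasDerivAt B ((1 / (1 - ‖w z‖ ^ 2) : ℝ) : ℂ) (w z) := by
    have hne := Complex.one_sub_conj_mul_ne_zero hw1 hw1
    have h := ((hasDerivAt_id (w z)).sub_const (w z)).div
      (((hasDerivAt_id (w z)).const_mul (conj (w z))).const_sub 1) hne
    refine HasDerivAt.congr_deriv (f := B) h ?_
    have := Complex.conj_mul' (w z)
    simp only [id]
    rw [this] at hne ⊢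
    push_cast
    field_simp
    ring
  have hwder : HasDerivAt w (deriv w z) z :=
    (hd.differentiableAt (isOpen_ball.mem_nhds hz)).hasDerivAt
  have hcomp : HasDerivAt (B ∘ w ∘ A)
      (((1 / (1 - ‖w z‖ ^ 2) : ℝ) : ℂ) * (deriv w z * ((1 - ‖z‖ ^ 2 : ℝ) : ℂ))) 0 := by
    refine HasDerivAt.comp (0 : ℂ) (h₂ := B) ?_ (HasDerivAt.comp (0 : ℂ) (h₂ := w) ?_ hAder)
    · simpa [hA0] using hBder
    · simpa [hA0] using hwder
  have hle := Complex.norm_deriv_le_one_of_mapsTo_ball (f := B ∘ w ∘ A) (c := 0) (R := 1)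
    (hBd.comp (hd.comp hAd hAm) (hm.comp hAm))
    (by
      have : (B ∘ w ∘ A) 0 = 0 := by simp [hA0, hBw]
      rw [this]
      exact (hBm.comp (hm.comp hAm)).mono_right ball_subset_closedBall) one_pos
  rw [hcomp.deriv, norm_mul, norm_mul, Complex.norm_real, Complex.norm_real, Real.norm_eq_abs,
    Real.norm_eq_abs, abs_of_pos hz2, abs_of_pos (one_div_pos.mpr hw2), one_div_mul_eq_div,
    div_le_one hw2] at hle
  exact hle

/-- The logarithmic derivative of a function with positive real part. -/
theorem norm_logDeriv_le_of_re_pos {p : ℂ → ℂ} (hd : DifferentiableOn ℂ p (ball 0 1))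
    (hp : ∀ z ∈ ball (0 : ℂ) 1, 0 < (p z).re) {z : ℂ} (hz : z ∈ ball (0 : ℂ) 1) :
    ‖deriv p z / p z‖ ≤ 2 / (1 - ‖z‖ ^ 2) := by
  have hz1 : ‖z‖ < 1 := by simpa using hz
  have hz2 : 0 < 1 - ‖z‖ ^ 2 := by nlinarith [norm_nonneg z]
  have hne : ∀ ζ ∈ ball (0 : ℂ) 1, p ζ + 1 ≠ 0 := by
    intro ζ hζ h
    have := congrArg Complex.re h
    simp at this
    linarith [hp ζ hζ]
  have hp0 : p z ≠ 0 := by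
    intro h
    have := hp z hz
    simp [h] at this
  -- The Cayley transform turns p into a self-map of the disk; Schwarz–Pick for it reads
  -- |p'|(1-|z|²) ≤ 2 Re p, and Re p ≤ |p|.
  set w : ℂ → ℂ := fun ζ => (p ζ - 1) / (p ζ + 1) with hw
  have hwd : DifferentiableOn ℂ w (ball 0 1) := (hd.sub_const 1).div (hd.add_const 1) hne
  have hsq : ∀ ζ, ‖p ζ + 1‖ ^ 2 - ‖p ζ - 1‖ ^ 2 = 4 * (p ζ).re := by
    intro ζ
    rw [Complex.sq_norm, Complex.sq_norm, Complex.normSq_apply, Complex.normSq_apply]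
    simp
    ring
  have hwm : Set.MapsTo w (ball 0 1) (ball 0 1) := by
    intro ζ hζ
    rw [mem_ball_zero_iff, norm_div, div_lt_one (norm_pos_iff.mpr (hne ζ hζ))]
    refine lt_of_pow_lt_pow_left₀ 2 (norm_nonneg _) ?_
    linarith [hsq ζ, hp ζ hζ]
  have hpd : HasDerivAt p (deriv p z) z :=
    (hd.differentiableAt (isOpen_ball.mem_nhds hz)).hasDerivAt
  have hwder : deriv w z = 2 * deriv p z / (p z + 1) ^ 2 := by
    have h := (hpd.sub_const 1).div (hpd.add_const 1) (hne z hz)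
    rw [show w = (fun ζ => (p ζ - 1) / (p ζ + 1)) from rfl]
    refine h.deriv.trans ?_
    congr 1
    ring
  have hN : 0 < ‖p z + 1‖ := norm_pos_iff.mpr (hne z hz)
  have key := Complex.norm_deriv_mul_le_of_mapsTo_unit_ball hwd hwm hz
  rw [hwder, hw, norm_div, norm_mul, norm_div, norm_pow, Complex.norm_ofNat, div_pow] at key
  have h1 : 1 - ‖p z - 1‖ ^ 2 / ‖p z + 1‖ ^ 2 = 4 * (p z).re / ‖p z + 1‖ ^ 2 := by
    rw [← hsq]; field_simp
  rw [h1, div_mul_eq_mul_div, div_le_div_iff_of_pos_right (by positivity)] at key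
  have h2 : (p z).re ≤ ‖p z‖ := Complex.re_le_norm _
  rw [norm_div, div_le_div_iff₀ (norm_pos_iff.mpr hp0) hz2]
  linarith

/-- The logarithmic derivative of a function with values in the unit disk centred at `1`. -/
theorem norm_logDeriv_le_of_norm_sub_one_lt {h : ℂ → ℂ} (hd : DifferentiableOn ℂ h (ball 0 1))
    (h0 : h 0 = 1) (hh : ∀ z ∈ ball (0 : ℂ) 1, ‖h z - 1‖ < 1) {z : ℂ} (hz : z ∈ ball (0 : ℂ) 1) :
    ‖deriv h z / h z‖ ≤ (1 + ‖z‖) / (1 - ‖z‖ ^ 2) := by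
  have hz1 : ‖z‖ < 1 := by simpa using hz
  have hz2 : 0 < 1 - ‖z‖ ^ 2 := by nlinarith [norm_nonneg z]
  set w : ℂ → ℂ := fun ζ => h ζ - 1 with hw
  have hwd : DifferentiableOn ℂ w (ball 0 1) := hd.sub_const 1
  have hwm : Set.MapsTo w (ball 0 1) (ball 0 1) := fun ζ hζ => by simpa using hh ζ hζ
  have key := Complex.norm_deriv_mul_le_of_mapsTo_unit_ball hwd hwm hz
  have hs : ‖w z‖ ≤ ‖z‖ := Complex.norm_le_norm_of_mapsTo_ball hwd
    (hwm.mono_right ball_subset_closedBall) (by simp [hw, h0]) hz1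
  have hwder : deriv w z = deriv h z := by simp [hw]
  rw [hwder] at key
  -- Dividing 1 - |w|² by this lower bound leaves 1 + |w|, which is at most 1 + |z| by the Schwarz
  -- lemma.
  have hge : 1 - ‖w z‖ ≤ ‖h z‖ := by
    have : ‖(1 : ℂ)‖ ≤ ‖h z‖ + ‖w z‖ := by
      have : (1 : ℂ) = h z - w z := by simp [hw]
      rw [this]; exact norm_sub_le _ _
    rw [norm_one] at this
    linarith
  have hpos : 0 < ‖h z‖ := by linarith
  rw [norm_div, div_le_div_iff₀ hpos hz2]
  nlinarith [norm_nonneg (w z), norm_nonneg z, mul_le_mul_of_nonneg_left hge (by positivity : 0 ≤ 1 + ‖w z‖)]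

/-! ### The quotient `z f' / f` on `Π₂` -/

/-- The quotient `z f'(z) / f(z)`, extended by `1` at the origin. -/
noncomputable abbrev starQuot (f : ℂ → ℂ) : ℂ → ℂ := quot1 (fun z => z * deriv f z) f

/-- Cancelling a factor z above and below removes the case distinction at 0; this is how analyticity
at the origin is obtained. -/
theorem quot1_eq_dslope_div_dslope {f g : ℂ → ℂ} (hf : f ∈ ClassA) (hg : g ∈ ClassA) (z : ℂ) :
    quot1 f g z = dslope f 0 z / dslope g 0 z := by
  by_cases hz : z = 0
  · simp [quot1, hz, hf.2.2, hg.2.2]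
  · have h1 := hf.2.1
    have h2 := hg.2.1
    rw [quot1, if_neg hz, dslope_of_ne _ hz, dslope_of_ne _ hz, slope_def_field, slope_def_field,
      h1, h2]
    field_simp
    simp

theorem starQuot_eq_deriv_div_dslope {f : ℂ → ℂ} (hf : f ∈ ClassA) (z : ℂ) :
    starQuot f z = deriv f z / dslope f 0 z := by
  by_cases hz : z = 0
  · simp [starQuot, quot1, hz, hf.2.2]
  · have h1 := hf.2.1
    rw [starQuot, quot1, if_neg hz, dslope_of_ne _ hz, slope_def_field, h1, sub_zero, sub_zero,
      div_div_eq_mul_div, mul_comm]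

theorem differentiableOn_dslope_zero {f : ℂ → ℂ} (hf : f ∈ ClassA) :
    DifferentiableOn ℂ (dslope f 0) (ball 0 1) :=
  (Complex.differentiableOn_dslope (ball_mem_nhds 0 one_pos)).mpr hf.1

theorem dslope_zero_ne_zero {f : ℂ → ℂ} (hf : f ∈ ClassA) {z : ℂ} (hz : z ≠ 0 → f z ≠ 0) :
    dslope f 0 z ≠ 0 := by
  by_cases h : z = 0
  · simp [h, hf.2.2]
  · rw [dslope_of_ne _ h, slope_def_field, hf.2.1]
    simpa using ⟨hz h, h⟩

theorem differentiableOn_quot1 {f g : ℂ → ℂ} (hf : f ∈ ClassA) (hg : g ∈ ClassA)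
    (hne : ∀ z ∈ ball (0 : ℂ) 1, z ≠ 0 → g z ≠ 0) :
    DifferentiableOn ℂ (quot1 f g) (ball 0 1) :=
  ((differentiableOn_dslope_zero hf).div (differentiableOn_dslope_zero hg)
    fun z hz => dslope_zero_ne_zero hg (hne z hz)).congr
      fun z _ => quot1_eq_dslope_div_dslope hf hg z

theorem differentiableOn_starQuot {f : ℂ → ℂ} (hf : f ∈ ClassA)
    (hne : ∀ z ∈ ball (0 : ℂ) 1, z ≠ 0 → f z ≠ 0) :
    DifferentiableOn ℂ (starQuot f) (ball 0 1) :=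
  ((hf.1.deriv isOpen_ball).div (differentiableOn_dslope_zero hf)
    fun z hz => dslope_zero_ne_zero hf (hne z hz)).congr
      fun z _ => starQuot_eq_deriv_div_dslope hf z

theorem starQuot_zero (f : ℂ → ℂ) : starQuot f 0 = 1 := by simp [starQuot, quot1]

theorem starQuot_eq_mul_logDeriv (f : ℂ → ℂ) {z : ℂ} (hz : z ≠ 0) :
    starQuot f z = z * logDeriv f z := by
  rw [starQuot, quot1, if_neg hz, logDeriv_apply, mul_div_assoc]

theorem one_sub_ne_zero_of_mem_ball {z : ℂ} (hz : z ∈ ball (0 : ℂ) 1) : 1 - z ≠ 0 := by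
  intro h
  have : z = 1 := (sub_eq_zero.mp h).symm
  simp [this] at hz

theorem one_add_ne_zero_of_mem_ball {z : ℂ} (hz : z ∈ ball (0 : ℂ) 1) : 1 + z ≠ 0 := by
  intro h
  have : z = -1 := (neg_eq_of_add_eq_zero_right h).symm
  simp [this] at hz

theorem hasDerivAt_koebe {z : ℂ} (hz : z ∈ ball (0 : ℂ) 1) :
    HasDerivAt koebe ((1 + z) / (1 - z) ^ 3) z := by
  have hne := one_sub_ne_zero_of_mem_ball hz
  have h := (hasDerivAt_id z).div (((hasDerivAt_id z).const_sub 1).pow 2) (pow_ne_zero 2 hne)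
  refine HasDerivAt.congr_deriv (f := koebe) h ?_
  simp only [id, Pi.pow_apply]
  field_simp
  push_cast
  ring

theorem koebe_mem_ClassA : koebe ∈ ClassA :=
  ⟨fun z hz => (hasDerivAt_koebe hz).differentiableAt.differentiableWithinAt, by simp [koebe],
    by simpa using (hasDerivAt_koebe (mem_ball_self one_pos)).deriv⟩

theorem koebe_ne_zero {z : ℂ} (hz : z ∈ ball (0 : ℂ) 1) (h0 : z ≠ 0) : koebe z ≠ 0 :=
  div_ne_zero h0 (pow_ne_zero 2 (one_sub_ne_zero_of_mem_ball hz))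

theorem starQuot_koebe {z : ℂ} (hz : z ∈ ball (0 : ℂ) 1) (h0 : z ≠ 0) :
    z * logDeriv koebe z = (1 + z) / (1 - z) := by
  have hne := one_sub_ne_zero_of_mem_ball hz
  rw [logDeriv_apply, (hasDerivAt_koebe hz).deriv, koebe]
  field_simp

/-- The Möbius map (1+z)/(1-z) sends |z| = r to the circle with real diameter from (1-r)/(1+r) to
(1+r)/(1-r). -/
theorem norm_starQuot_koebe_sub_center {z : ℂ} (hz : z ∈ ball (0 : ℂ) 1) :
    ‖(1 + z) / (1 - z) - (((1 + ‖z‖ ^ 2) / (1 - ‖z‖ ^ 2) : ℝ) : ℂ)‖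
      = 2 * ‖z‖ / (1 - ‖z‖ ^ 2) := by
  have hz1 : ‖z‖ < 1 := by simpa using hz
  have hz2 : 0 < 1 - ‖z‖ ^ 2 := by nlinarith [norm_nonneg z]
  have hne := one_sub_ne_zero_of_mem_ball hz
  have hz3 : (1 - (‖z‖ : ℂ) ^ 2) ≠ 0 := by exact_mod_cast hz2.ne'
  have hc : ‖1 - conj z‖ = ‖1 - z‖ := by
    rw [← Complex.norm_conj (1 - z)]; simp
  have : (1 + z) / (1 - z) - (((1 + ‖z‖ ^ 2) / (1 - ‖z‖ ^ 2) : ℝ) : ℂ)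
      = 2 * z * (1 - conj z) / ((1 - z) * ((1 - ‖z‖ ^ 2 : ℝ) : ℂ)) := by
    push_cast
    field_simp
    rw [← Complex.mul_conj' z]
    ring
  rw [this, norm_div, norm_mul, norm_mul, norm_mul, hc, Complex.norm_real, Complex.norm_ofNat,
    Real.norm_eq_abs, abs_of_pos hz2]
  have := norm_pos_iff.mpr hne
  field_simp

/-- A zero of g would give Re(g/k) = 0 and a zero of f would give |f/g - 1| = 1, against the strict
inequalities. -/
theorem ClassPi2_ne_zero {f g : ℂ → ℂ} (hP : quot1 g koebe ∈ ClassP)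
    (hh : ∀ z ∈ ball (0 : ℂ) 1, ‖quot1 f g z - 1‖ < 1) {z : ℂ} (hz : z ∈ ball (0 : ℂ) 1)
    (h0 : z ≠ 0) : g z ≠ 0 ∧ f z ≠ 0 := by
  have h1 := hP.2.2 z hz
  have h2 := hh z hz
  rw [quot1, if_neg h0] at h1 h2
  constructor <;> rintro h <;> simp [h] at h1 h2

theorem ne_zero_of_mem_ClassPi2 {f : ℂ → ℂ} (hf : f ∈ ClassPi2) {z : ℂ}
    (hz : z ∈ ball (0 : ℂ) 1) (h0 : z ≠ 0) : f z ≠ 0 := by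
  obtain ⟨-, g, -, hP, hh⟩ := hf
  exact (ClassPi2_ne_zero hP hh hz h0).2

theorem norm_starQuot_sub_center_le {f : ℂ → ℂ} (hf : f ∈ ClassPi2) {z : ℂ}
    (hz : z ∈ ball (0 : ℂ) 1) :
    ‖starQuot f z - (((1 + ‖z‖ ^ 2) / (1 - ‖z‖ ^ 2) : ℝ) : ℂ)‖
      ≤ (5 * ‖z‖ + ‖z‖ ^ 2) / (1 - ‖z‖ ^ 2) := by
  by_cases h0 : z = 0
  · simp [h0, starQuot_zero]
  have hz1 : ‖z‖ < 1 := by simpa using hz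
  have hz2 : 0 < 1 - ‖z‖ ^ 2 := by nlinarith [norm_nonneg z]
  obtain ⟨hfA, g, hgA, hP, hh⟩ := hf
  have hne : ∀ ζ ∈ ball (0 : ℂ) 1, ζ ≠ 0 → g ζ ≠ 0 :=
    fun ζ hζ hζ0 => (ClassPi2_ne_zero hP hh hζ hζ0).1
  set p := quot1 g koebe with hp
  set h := quot1 f g with hh'
  have hhd : DifferentiableOn ℂ h (ball 0 1) := differentiableOn_quot1 hfA hgA hne
  have heq : f =ᶠ[nhds z] fun ζ => koebe ζ * p ζ * h ζ := by
    filter_upwards [isOpen_ball.mem_nhds hz, isOpen_ne.mem_nhds h0] with ζ hζ hζ0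
    have h1 := koebe_ne_zero hζ hζ0
    have h2 := hne ζ hζ hζ0
    rw [hp, hh', quot1, quot1, if_neg hζ0, if_neg hζ0]
    field_simp
  have hpz : p z ≠ 0 := by
    intro h
    have := hP.2.2 z hz
    simp [h] at this
  have hhz : h z ≠ 0 := by
    intro h
    have := hh z hz
    simp [h] at this
  have hkz := koebe_ne_zero hz h0
  have hkd := (hasDerivAt_koebe hz).differentiableAt
  have hpd := hP.1.differentiableAt (isOpen_ball.mem_nhds hz)
  have hhd' := hhd.differentiableAt (isOpen_ball.mem_nhds hz)
  have hlog : logDeriv f z = logDeriv koebe z + logDeriv p z + logDeriv h z := by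
    have : logDeriv f z = logDeriv (fun ζ => koebe ζ * p ζ * h ζ) z := by
      rw [logDeriv_apply, logDeriv_apply, heq.deriv_eq, heq.eq_of_nhds]
    rw [this, logDeriv_mul (f := fun ζ => koebe ζ * p ζ) z (mul_ne_zero hkz hpz) hhz
      (hkd.mul hpd) hhd', logDeriv_mul z hkz hpz hkd hpd]
  rw [starQuot_eq_mul_logDeriv _ h0, hlog, mul_add, mul_add, starQuot_koebe hz h0]
  have b1 := norm_logDeriv_le_of_re_pos hP.1 hP.2.2 hz
  have b2 := norm_logDeriv_le_of_norm_sub_one_lt hhd (by simp [hh', quot1]) hh hz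
  calc _ = ‖((1 + z) / (1 - z) - (((1 + ‖z‖ ^ 2) / (1 - ‖z‖ ^ 2) : ℝ) : ℂ))
          + z * logDeriv p z + z * logDeriv h z‖ := by congr 1; ring
    _ ≤ 2 * ‖z‖ / (1 - ‖z‖ ^ 2) + ‖z‖ * (2 / (1 - ‖z‖ ^ 2))
          + ‖z‖ * ((1 + ‖z‖) / (1 - ‖z‖ ^ 2)) := by
        refine (norm_add₃_le).trans ?_
        rw [norm_starQuot_koebe_sub_center hz, norm_mul, norm_mul]
        gcongr
        · exact b1
        · exact b2
    _ = _ := by ring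

/-- Below the radius `R` the values of `z f' / f` stay in a disk touching the abscissa `m`. -/
theorem starQuot_mem_ball {f : ℂ → ℂ} (hf : f ∈ ClassPi2) {m R : ℝ} (hm0 : 0 ≤ m) (hm1 : m < 1)
    (hR0 : 0 ≤ R) (hR1 : R < 1) (hR : m * R ^ 2 - 5 * R + 1 - m = 0) {z : ℂ} (hz : ‖z‖ < R) :
    starQuot f z ∈ ball ((√2 : ℝ) : ℂ) (√2 - m) := by
  have hz' : z ∈ ball (0 : ℂ) 1 := by simpa using hz.trans hR1
  have hb := norm_starQuot_sub_center_le hf hz'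
  set r := ‖z‖
  have hr0 : 0 ≤ r := norm_nonneg z
  -- The equation says 5R = 1 - m(1 - R²) ≤ 1. This keeps the centre c below √2, so a disk about c
  -- to the right of m stays in the disk about √2 through m.
  have hR5 : R ≤ 1 / 5 := by
    nlinarith [mul_nonneg hm0 (by nlinarith : 0 ≤ 1 - R ^ 2)]
  have hr2 : 0 < 1 - r ^ 2 := by nlinarith
  have hs : 1.4 < √2 := by
    rw [Real.lt_sqrt (by norm_num)]; norm_num
  set c := (1 + r ^ 2) / (1 - r ^ 2) with hc
  have hcs : c ≤ √2 := by
    have : c ≤ 1.4 := by rw [hc, div_le_iff₀ hr2]; nlinarith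
    linarith
  -- Subtracting the equation for R leaves (R - r)(5 - m(r + R)) > 0.
  have hlt : (5 * r + r ^ 2) / (1 - r ^ 2) < c - m := by
    rw [hc, lt_sub_comm, ← sub_div, lt_div_iff₀ hr2]
    nlinarith [mul_pos (sub_pos.mpr hz) (by nlinarith : 0 < 5 - m * (r + R))]
  rw [mem_ball_iff_norm]
  calc _ = ‖(starQuot f z - (c : ℂ)) + ((c : ℂ) - (√2 : ℝ))‖ := by congr 1; ring
    _ ≤ ‖starQuot f z - (c : ℂ)‖ + ‖(c : ℂ) - ((√2 : ℝ) : ℂ)‖ := norm_add_le _ _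
    _ < (c - m) + (√2 - c) := by
        have : ‖(c : ℂ) - ((√2 : ℝ) : ℂ)‖ = √2 - c := by
          rw [← Complex.ofReal_sub, Complex.norm_real, Real.norm_eq_abs, abs_sub_comm,
            abs_of_nonneg (by linarith)]
        rw [this]
        linarith
    _ = _ := by ring

/-- Below the radius `R` the values of `z f' / f` stay in a disk centred at `1`. -/
theorem starQuot_mem_ball_one {f : ℂ → ℂ} (hf : f ∈ ClassPi2) {M R : ℝ} (hM : 0 < M)
    (hR0 : 0 ≤ R) (hR1 : R < 1) (hR : (2 + M) * R ^ 2 + 5 * R = M - 1) {z : ℂ} (hz : ‖z‖ < R) :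
    starQuot f z ∈ ball (1 : ℂ) (M - 1) := by
  have hz' : z ∈ ball (0 : ℂ) 1 := by simpa using hz.trans hR1
  have hb := norm_starQuot_sub_center_le hf hz'
  set r := ‖z‖
  have hr0 : 0 ≤ r := norm_nonneg z
  have hr2 : 0 < 1 - r ^ 2 := by nlinarith
  set c := (1 + r ^ 2) / (1 - r ^ 2) with hc
  have hc1 : 1 ≤ c := by rw [le_div_iff₀ hr2]; nlinarith
  -- The equation for R says that the right end (1+5R+2R²)/(1-R²) equals M.
  have hlt : (5 * r + r ^ 2) / (1 - r ^ 2) < M - c := by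
    rw [lt_sub_iff_add_lt, hc, ← add_div, div_lt_iff₀ hr2]
    nlinarith [mul_pos (sub_pos.mpr hz) (by positivity : 0 < (2 + M) * (R + r) + 5)]
  rw [mem_ball_iff_norm]
  calc _ = ‖(starQuot f z - (c : ℂ)) + ((c : ℂ) - (1 : ℝ))‖ := by
        congr 1; push_cast; ring
    _ ≤ ‖starQuot f z - (c : ℂ)‖ + ‖(c : ℂ) - (1 : ℝ)‖ := norm_add_le _ _
    _ < (M - c) + (c - 1) := by
        rw [← Complex.ofReal_sub c 1, Complex.norm_real, Real.norm_eq_abs,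
          abs_of_nonneg (by linarith)]
        linarith
    _ = _ := by ring

/-! ### Dilations, radii and the extremal function -/

theorem starQuot_dilate (f : ℂ → ℂ) {r : ℝ} (hr : 0 < r) (z : ℂ) :
    starQuot (dilate r f) z = starQuot f (r * z) := by
  have hr' : (r : ℂ) ≠ 0 := by exact_mod_cast hr.ne'
  by_cases hz : z = 0
  · simp [starQuot, quot1, hz]
  · have hd : deriv (dilate r f) z = deriv f (r * z) := by
      have h1 : dilate r f = fun z => (r : ℂ)⁻¹ * f (r * z) := rfl
      rw [h1, deriv_const_mul_field, deriv_comp_mul_left, smul_eq_mul, inv_mul_cancel_left₀ hr']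
    simp only [starQuot, quot1, if_neg hz, if_neg (mul_ne_zero hr' hz), hd, dilate]
    field_simp

theorem real_mul_mem_ball {r : ℝ} (hr : 0 < r) (hr1 : r ≤ 1) {z : ℂ} (hz : z ∈ ball (0 : ℂ) 1) :
    (r : ℂ) * z ∈ ball (0 : ℂ) 1 := by
  have hz1 : ‖z‖ < 1 := by simpa using hz
  rw [mem_ball_zero_iff, norm_mul, Complex.norm_real, Real.norm_eq_abs, abs_of_pos hr]
  nlinarith [norm_nonneg z]

theorem dilate_mem_ClassA {f : ℂ → ℂ} (hf : f ∈ ClassA) {r : ℝ} (hr : 0 < r) (hr1 : r ≤ 1) :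
    dilate r f ∈ ClassA := by
  have hr' : (r : ℂ) ≠ 0 := by exact_mod_cast hr.ne'
  refine ⟨?_, by simp [dilate, hf.2.1], ?_⟩
  · have : DifferentiableOn ℂ (fun z => f (r * z)) (ball 0 1) :=
      hf.1.comp (by fun_prop) fun z hz => real_mul_mem_ball hr hr1 hz
    exact this.const_mul _
  · have h1 : dilate r f = fun z => (r : ℂ)⁻¹ * f (r * z) := rfl
    rw [h1, deriv_const_mul_field, deriv_comp_mul_left, smul_eq_mul, inv_mul_cancel_left₀ hr',
      mul_zero, hf.2.2]

/-- A right inverse ψ of φ on a set containing the values of zf'/f is enough: ψ ∘ (zf'/f) is the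
subordinating map, and univalence of φ plays no role. -/
theorem dilate_mem_StarClass {φ ψ : ℂ → ℂ} {Ω : Set ℂ} (hψ : DifferentiableOn ℂ ψ Ω)
    (hψ1 : ψ 1 = 0) (hmaps : Set.MapsTo ψ Ω (ball 0 1)) (hinv : ∀ w ∈ Ω, φ (ψ w) = w)
    {f : ℂ → ℂ} (hf : f ∈ ClassPi2) {r : ℝ} (hr : 0 < r) (hr1 : r ≤ 1)
    (hΩ : ∀ z : ℂ, ‖z‖ < r → starQuot f z ∈ Ω) : dilate r f ∈ StarClass φ := by
  have hr' : (r : ℂ) ≠ 0 := by exact_mod_cast hr.ne'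
  have hΩ' : ∀ z ∈ ball (0 : ℂ) 1, starQuot f (r * z) ∈ Ω := by
    intro z hz
    have hz1 : ‖z‖ < 1 := by simpa using hz
    refine hΩ _ ?_
    rw [norm_mul, Complex.norm_real, Real.norm_eq_abs, abs_of_pos hr]
    nlinarith
  have hd : DifferentiableOn ℂ (fun z => starQuot f (r * z)) (ball 0 1) :=
    (differentiableOn_starQuot hf.1 fun z hz h0 => ne_zero_of_mem_ClassPi2 hf hz h0).comp
      (by fun_prop) fun z hz => real_mul_mem_ball hr hr1 hz
  refine ⟨dilate_mem_ClassA hf.1 hr hr1, fun z hz h0 => ?_, fun z => ψ (starQuot f (r * z)),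
    hψ.comp hd hΩ', by simp [starQuot_zero, hψ1], fun z hz => hmaps (hΩ' z hz), fun z hz => ?_⟩
  · exact mul_ne_zero (inv_ne_zero hr')
      (ne_zero_of_mem_ClassPi2 hf (real_mul_mem_ball hr hr1 hz) (mul_ne_zero hr' h0))
  · change starQuot (dilate r f) z = _
    rw [starQuot_dilate f hr, hinv _ (hΩ' z hz)]

theorem hasDerivAt_f3 {z : ℂ} (hz : z ∈ ball (0 : ℂ) 1) :
    HasDerivAt f3 ((1 + z) * (1 + 5 * z) / (1 - z) ^ 4) z := by
  have hne := one_sub_ne_zero_of_mem_ball hz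
  have h := ((hasDerivAt_id z).mul (((hasDerivAt_id z).const_add 1).pow 2)).div
    (((hasDerivAt_id z).const_sub 1).pow 3) (pow_ne_zero 3 hne)
  refine HasDerivAt.congr_deriv (f := f3) h ?_
  simp only [id, Pi.pow_apply, Pi.mul_apply]
  field_simp
  push_cast
  ring

theorem f3_mem_ClassA : f3 ∈ ClassA :=
  ⟨fun z hz => (hasDerivAt_f3 hz).differentiableAt.differentiableWithinAt, by simp [f3],
    by simpa using (hasDerivAt_f3 (mem_ball_self one_pos)).deriv⟩

theorem re_one_add_div_one_sub_pos {z : ℂ} (hz : z ∈ ball (0 : ℂ) 1) :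
    0 < ((1 + z) / (1 - z)).re := by
  have hne := one_sub_ne_zero_of_mem_ball hz
  have hz1 : ‖z‖ < 1 := by simpa using hz
  rw [Complex.div_re, ← add_div]
  refine div_pos ?_ (Complex.normSq_pos.mpr hne)
  have h2 : ‖z‖ ^ 2 < 1 := by nlinarith [norm_nonneg z]
  rw [Complex.sq_norm, Complex.normSq_apply] at h2
  simp
  nlinarith

/-- The witness is g = k·(1+z)/(1-z), which leaves `f3`/g = 1 + z. -/
theorem f3_mem_ClassPi2 : f3 ∈ ClassPi2 := by
  have hg : ∀ z ∈ ball (0 : ℂ) 1,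
      HasDerivAt (fun z : ℂ => z * (1 + z) / (1 - z) ^ 3) ((1 + 4 * z + z ^ 2) / (1 - z) ^ 4) z := by
    intro z hz
    have hne := one_sub_ne_zero_of_mem_ball hz
    have h := ((hasDerivAt_id z).mul ((hasDerivAt_id z).const_add 1)).div
      (((hasDerivAt_id z).const_sub 1).pow 3) (pow_ne_zero 3 hne)
    refine HasDerivAt.congr_deriv (f := fun z : ℂ => z * (1 + z) / (1 - z) ^ 3) h ?_
    simp only [id, Pi.pow_apply, Pi.mul_apply]
    field_simp
    push_cast
    ring
  have hgA : (fun z : ℂ => z * (1 + z) / (1 - z) ^ 3) ∈ ClassA :=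
    ⟨fun z hz => (hg z hz).differentiableAt.differentiableWithinAt, by simp,
      by simpa using (hg 0 (mem_ball_self one_pos)).deriv⟩
  refine ⟨f3_mem_ClassA, _, hgA, ⟨differentiableOn_quot1 hgA koebe_mem_ClassA
    fun z hz h0 => koebe_ne_zero hz h0, by simp [quot1], fun z hz => ?_⟩, fun z hz => ?_⟩
  · by_cases h0 : z = 0
    · simp [quot1, h0]
    have hne := one_sub_ne_zero_of_mem_ball hz
    have : z * (1 + z) / (1 - z) ^ 3 / koebe z = (1 + z) / (1 - z) := by
      rw [koebe]; field_simp
    rw [quot1, if_neg h0, this]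
    exact re_one_add_div_one_sub_pos hz
  · by_cases h0 : z = 0
    · simp [quot1, h0]
    have hne := one_sub_ne_zero_of_mem_ball hz
    have hne' := one_add_ne_zero_of_mem_ball hz
    have : f3 z / (z * (1 + z) / (1 - z) ^ 3) = 1 + z := by
      rw [f3]; field_simp
    rw [quot1, if_neg h0, this]
    simpa using hz

theorem starQuot_f3_neg {t : ℝ} (h0 : 0 < t) (h1 : t < 1) :
    starQuot f3 (-t : ℝ) = ((1 - 5 * t) / (1 - t ^ 2) : ℝ) := by
  have hz : ((-t : ℝ) : ℂ) ∈ ball (0 : ℂ) 1 := by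
    rw [mem_ball_zero_iff, Complex.norm_real, Real.norm_eq_abs, abs_neg, abs_of_pos h0]
    exact h1
  have hz0 : ((-t : ℝ) : ℂ) ≠ 0 := by exact_mod_cast (neg_ne_zero.mpr h0.ne')
  have hne := one_sub_ne_zero_of_mem_ball hz
  have hne' := one_add_ne_zero_of_mem_ball hz
  rw [starQuot, quot1, if_neg hz0, (hasDerivAt_f3 hz).deriv, f3]
  have hp : 1 - (t : ℂ) ^ 2 = (1 + ((-t : ℝ) : ℂ)) * (1 - ((-t : ℝ) : ℂ)) := by push_cast; ring
  rw [Complex.ofReal_div, Complex.ofReal_sub, Complex.ofReal_sub, Complex.ofReal_pow,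
    Complex.ofReal_one, hp]
  field_simp
  push_cast
  ring

/-- The value (1-5t)/(1-t²) equals m at t = R and, by continuity, is still above l just after it.
Later it therefore suffices that φ omits a short real interval (l, m). -/
theorem exists_starQuot_f3_mem_Ioo {m R l r : ℝ} (hm1 : m < 1)
    (hR0 : 0 ≤ R) (hR1 : R < 1) (hR : m * R ^ 2 - 5 * R + 1 - m = 0) (hl : l < m) (hr : R < r)
    (hr1 : r ≤ 1) : ∃ t : ℝ, 0 < t ∧ t < r ∧ ∃ v ∈ Set.Ioo l m, starQuot f3 (-t : ℝ) = (v : ℝ) := by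
  have hval : (1 - 5 * R) / (1 - R ^ 2) = m := by
    rw [div_eq_iff (by nlinarith)]; linarith
  have hc : ContinuousAt (fun t : ℝ => (1 - 5 * t) / (1 - t ^ 2)) R :=
    ContinuousAt.div (by fun_prop) (by fun_prop) (by nlinarith)
  have h1 : ∀ᶠ t in nhdsWithin R (Set.Ioi R), l < (1 - 5 * t) / (1 - t ^ 2) :=
    (hc.eventually (lt_mem_nhds (hl.trans_eq hval.symm))).filter_mono nhdsWithin_le_nhds
  obtain ⟨t, hlt, htR, htr⟩ := (h1.and (Ioo_mem_nhdsGT hr)).exists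
  have ht1 : t < 1 := htr.trans_le hr1
  have ht0 : 0 < t := hR0.trans_lt htR
  refine ⟨t, ht0, htr, _, ⟨hlt, ?_⟩, starQuot_f3_neg ht0 ht1⟩
  rw [div_lt_iff₀ (by nlinarith)]
  nlinarith [mul_pos (sub_pos.mpr htR) (by nlinarith : 0 < 5 - m * (t + R))]

theorem dilate_f3_notMem_StarClass {φ : ℂ → ℂ} {m R l : ℝ} (hm1 : m < 1)
    (hR0 : 0 ≤ R) (hR1 : R < 1) (hR : m * R ^ 2 - 5 * R + 1 - m = 0) (hl : l < m)
    (hφ : ∀ v ∈ Set.Ioo l m, ∀ z ∈ ball (0 : ℂ) 1, φ z ≠ (v : ℝ)) {r : ℝ} (hr : R < r)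
    (hr1 : r ≤ 1) : dilate r f3 ∉ StarClass φ := by
  rintro ⟨-, -, w, -, -, hw, heq⟩
  obtain ⟨t, ht0, htr, v, hv, hval⟩ := exists_starQuot_f3_mem_Ioo hm1 hR0 hR1 hR hl hr hr1
  have hr0 : 0 < r := hR0.trans_lt hr
  have hz : ((-t / r : ℝ) : ℂ) ∈ ball (0 : ℂ) 1 := by
    rw [mem_ball_zero_iff, Complex.norm_real, Real.norm_eq_abs, abs_div, abs_neg, abs_of_pos ht0,
      abs_of_pos hr0, div_lt_one hr0]
    exact htr
  refine hφ v hv _ (hw _ hz) ?_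
  rw [← heq _ hz, ← hval, ← starQuot, starQuot_dilate f3 hr0]
  congr 1
  rw [← Complex.ofReal_mul]
  congr 1
  field_simp

theorem isSharpRadius_of_forall {𝒢 ℱ : Set (ℂ → ℂ)} {f₀ : ℂ → ℂ} {R : ℝ} (hR0 : 0 ≤ R)
    (hR1 : R ≤ 1) (hf₀ : f₀ ∈ ℱ)
    (hin : ∀ f ∈ ℱ, ∀ r : ℝ, 0 < r → r < R → dilate r f ∈ 𝒢)
    (hout : ∀ r : ℝ, R < r → r ≤ 1 → dilate r f₀ ∉ 𝒢) : IsSharpRadius 𝒢 ℱ f₀ R := by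
  refine ⟨⟨⟨hR0, hR1, hin⟩, ?_⟩, hf₀, hout⟩
  rintro ρ ⟨-, hρ1, hρ⟩
  by_contra! h
  obtain ⟨r, hr, hr'⟩ := exists_between h
  exact hout r hr (hr'.le.trans hρ1) (hρ f₀ hf₀ r (hR0.trans_lt hr) hr')

/-- The condition on ρ concerns only r < ρ, so the supremum of admissible ρ is itself admissible and
a radius exists without being computed. -/
theorem exists_isRadius_ge {𝒢 ℱ : Set (ℂ → ℂ)} {b : ℝ} (hb0 : 0 ≤ b) (hb1 : b ≤ 1)
    (hin : ∀ f ∈ ℱ, ∀ r : ℝ, 0 < r → r < b → dilate r f ∈ 𝒢) : ∃ R, IsRadius 𝒢 ℱ R ∧ b ≤ R := by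
  set S := {ρ : ℝ | 0 ≤ ρ ∧ ρ ≤ 1 ∧ ∀ f ∈ ℱ, ∀ r : ℝ, 0 < r → r < ρ → dilate r f ∈ 𝒢} with hS
  have hbS : b ∈ S := ⟨hb0, hb1, hin⟩
  have hbd : BddAbove S := ⟨1, fun ρ hρ => hρ.2.1⟩
  have hle : b ≤ sSup S := le_csSup hbd hbS
  refine ⟨sSup S, ⟨⟨hb0.trans hle, csSup_le ⟨b, hbS⟩ fun ρ hρ => hρ.2.1, ?_⟩,
    fun ρ hρ => le_csSup hbd hρ⟩, hle⟩
  intro f hf r hr0 hr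
  obtain ⟨ρ, hρ, hrρ⟩ := exists_lt_of_lt_csSup ⟨b, hbS⟩ hr
  exact hρ.2.2 f hf r hr0 hrρ

theorem isSharpRadius_StarClass {φ ψ : ℂ → ℂ} {m R l : ℝ} (hm0 : 0 ≤ m) (hm1 : m < 1)
    (hR0 : 0 ≤ R) (hR1 : R < 1) (hR : m * R ^ 2 - 5 * R + 1 - m = 0)
    (hψ : DifferentiableOn ℂ ψ (ball ((√2 : ℝ) : ℂ) (√2 - m))) (hψ1 : ψ 1 = 0)
    (hmaps : Set.MapsTo ψ (ball ((√2 : ℝ) : ℂ) (√2 - m)) (ball 0 1))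
    (hinv : ∀ w ∈ ball ((√2 : ℝ) : ℂ) (√2 - m), φ (ψ w) = w) (hl : l < m)
    (hφ : ∀ v ∈ Set.Ioo l m, ∀ z ∈ ball (0 : ℂ) 1, φ z ≠ (v : ℝ)) :
    IsSharpRadius (StarClass φ) ClassPi2 f3 R :=
  isSharpRadius_of_forall hR0 hR1.le f3_mem_ClassPi2
    (fun _ hf _ hr0 hr => dilate_mem_StarClass hψ hψ1 hmaps hinv hf hr0 (hr.le.trans hR1.le)
      fun _ hz => starQuot_mem_ball hf hm0 hm1 hR0 hR1 hR (hz.trans hr))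
    fun _ hr hr1 => dilate_f3_notMem_StarClass hm1 hR0 hR1 hR hl hφ hr hr1

/-! ### Principal square roots and disks with real centre -/

theorem Complex.cpow_half_sq (u : ℂ) : (u ^ (1 / 2 : ℂ)) ^ 2 = u := by
  rw [one_div]
  exact Complex.cpow_ofNat_inv_pow u 2

theorem Complex.sq_cpow_half {s : ℂ} (hs : 0 < s.re) : (s ^ 2) ^ (1 / 2 : ℂ) = s := by
  rw [one_div]
  exact Complex.sq_cpow_two_inv hs

/-- Off the slit the argument lies strictly between -π and π; halving it lands in the right
half-plane. -/
theorem Complex.cpow_half_re_pos {u : ℂ} (hu : u ∈ Complex.slitPlane) :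
    0 < (u ^ (1 / 2 : ℂ)).re := by
  rw [Complex.cpow_def_of_ne_zero (Complex.slitPlane_ne_zero hu), Complex.exp_re]
  refine mul_pos (Real.exp_pos _) (Real.cos_pos_of_mem_Ioo ?_)
  have him : (Complex.log u * (1 / 2)).im = u.arg / 2 := by
    have : (Complex.log u * (1 / 2)) = ((1 / 2 : ℝ) : ℂ) * Complex.log u := by push_cast; ring
    rw [this, Complex.im_ofReal_mul, Complex.log_im]
    ring
  have h1 := Complex.neg_pi_lt_arg u
  have h2 := (Complex.arg_le_pi u).lt_of_ne (Complex.mem_slitPlane_iff_arg.mp hu).1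
  rw [him]
  constructor <;> linarith

theorem Complex.differentiableAt_cpow_half {u : ℂ} (hu : u ∈ Complex.slitPlane) :
    DifferentiableAt ℂ (fun u : ℂ => u ^ (1 / 2 : ℂ)) u :=
  differentiableAt_id.cpow_const hu

theorem mem_ball_ofReal_iff {w : ℂ} {a ρ : ℝ} (hρ : 0 ≤ ρ) :
    w ∈ ball (a : ℂ) ρ ↔ (w.re - a) ^ 2 + w.im ^ 2 < ρ ^ 2 := by
  rw [mem_ball_iff_norm, ← sq_lt_sq₀ (norm_nonneg _) hρ, Complex.sq_norm, Complex.normSq_apply]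
  simp [sq]

theorem lt_re_of_mem_ball_ofReal {w : ℂ} {a m : ℝ} (hw : w ∈ ball (a : ℂ) (a - m)) :
    m < w.re := by
  have h1 := mem_ball_iff_norm.mp hw
  have h2 := (abs_le.mp ((Complex.abs_re_le_norm _).trans h1.le)).1
  have h3 := Complex.abs_re_le_norm (w - a)
  have h4 := neg_abs_le (w - a).re
  simp at h4 h3
  linarith

theorem Complex.norm_lt_norm_of_re_im {u v : ℂ}
    (h : u.re ^ 2 + u.im ^ 2 < v.re ^ 2 + v.im ^ 2) : ‖u‖ < ‖v‖ := by
  refine lt_of_pow_lt_pow_left₀ 2 (norm_nonneg _) ?_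
  rw [Complex.sq_norm, Complex.sq_norm, Complex.normSq_apply, Complex.normSq_apply]
  linarith

theorem one_mem_ball_sqrt_two {m : ℝ} (hm : m < 1) : (1 : ℂ) ∈ ball ((√2 : ℝ) : ℂ) (√2 - m) := by
  have h : 1 < √2 := by rw [Real.lt_sqrt] <;> norm_num
  rw [← Complex.ofReal_one, mem_ball_ofReal_iff (by linarith)]
  simp
  nlinarith

/-! ### Starlikeness of order `α` -/

/-- Here φ(𝔻) is the half-plane Re w > α, so m = α, and l = α - 1 is an arbitrary smaller number.
The rationalised form of the root remains valid at α = 0, where the quadratic becomes linear. -/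
theorem isSharpRadius_phiOrder {α : ℝ} (h0 : 0 ≤ α) (h1 : α < 1) :
    IsSharpRadius (StarClass (phiOrder α)) ClassPi2 f3
      (2 * (1 - α) / (5 + √(4 * α ^ 2 - 4 * α + 25))) := by
  set s := √(4 * α ^ 2 - 4 * α + 25) with hs
  have hs2 : s ^ 2 = 4 * α ^ 2 - 4 * α + 25 := Real.sq_sqrt (by nlinarith)
  have hs0 : 0 ≤ s := Real.sqrt_nonneg _
  have hne : ∀ w ∈ ball ((√2 : ℝ) : ℂ) (√2 - α), w + (1 - 2 * (α : ℂ)) ≠ 0 := by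
    intro w hw h
    have hre := lt_re_of_mem_ball_ofReal hw
    have := congrArg Complex.re h
    simp at this
    linarith
  refine isSharpRadius_StarClass (m := α) (l := α - 1)
    (ψ := fun w => (w - 1) / (w + (1 - 2 * (α : ℂ)))) h0 h1 (by
      have : 0 ≤ 1 - α := by linarith
      positivity) ?_ ?_ ?_ (by simp) ?_ ?_ (by linarith) ?_
  · rw [div_lt_one (by linarith)]; linarith
  · field_simp
    linear_combination (1 - α) * hs2
  · exact DifferentiableOn.div (by fun_prop) (by fun_prop) hne
  · intro w hw
    rw [mem_ball_zero_iff, norm_div, div_lt_one (norm_pos_iff.mpr (hne w hw))]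
    have hre := lt_re_of_mem_ball_ofReal hw
    apply Complex.norm_lt_norm_of_re_im
    simp
    nlinarith
  · intro w hw
    have hw' := hne w hw
    have hα : 1 - (α : ℂ) ≠ 0 := by exact_mod_cast (sub_pos.mpr h1).ne'
    have e1 : 1 - (w - 1) / (w + (1 - 2 * (α : ℂ)))
        = 2 * (1 - (α : ℂ)) / (w + (1 - 2 * (α : ℂ))) := by
      field_simp; ring
    rw [phiOrder, e1]
    field_simp
    ring
  · intro v hv z hz h
    have hz1 := one_sub_ne_zero_of_mem_ball hz
    rw [phiOrder, div_eq_iff hz1] at h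
    have hzn : ‖z‖ ^ 2 < 1 := by
      have : ‖z‖ < 1 := by simpa using hz
      nlinarith [norm_nonneg z]
    rw [Complex.sq_norm, Complex.normSq_apply] at hzn
    have h3 := congrArg Complex.re h
    have h4 := congrArg Complex.im h
    simp at h3 h4
    have hv2 := hv.2
    have hv1 := hv.1
    have him : z.im * (1 - 2 * α + v) = 0 := by linarith
    have hre : z.re * (1 - 2 * α + v) = v - 1 := by linarith
    by_cases hc : 1 - 2 * α + v = 0
    · rw [hc] at hre; linarith
    · have hx2 : z.re ^ 2 < 1 := by nlinarith [sq_nonneg z.im]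
      have : (v - 1) ^ 2 < (1 - 2 * α + v) ^ 2 := by
        rw [← hre, mul_pow]
        have : 0 < (1 - 2 * α + v) ^ 2 := by positivity
        nlinarith
      nlinarith

/-! ### The lemniscate class -/

/-- With M = √2, |w² - 1| = |w - 1||w + 1| < (√2 - 1)(√2 + 1) = 1 on the disk |w - 1| < √2 - 1. -/
theorem exists_isRadius_phiL :
    ∃ R : ℝ, IsRadius (StarClass phiL) ClassPi2 R ∧
      (√(4 * √2 + 25) - 5) / (2 * (√2 + 2)) ≤ R := by
  have hq2 : √2 ^ 2 = 2 := Real.sq_sqrt (by norm_num)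
  have hq0 : 0 ≤ √2 := Real.sqrt_nonneg _
  have hq : 1 < √2 := by rw [Real.lt_sqrt] <;> norm_num
  have hq' : √2 < 1.5 := by rw [Real.sqrt_lt'] <;> norm_num
  set s := √(4 * √2 + 25) with hs
  have hs2 : s ^ 2 = 4 * √2 + 25 := Real.sq_sqrt (by positivity)
  have hs5 : 5 ≤ s := Real.le_sqrt_of_sq_le (by linarith)
  have hs6 : s ≤ 6 := Real.sqrt_le_iff.mpr ⟨by norm_num, by linarith⟩
  have hb1 : (s - 5) / (2 * (√2 + 2)) < 1 := by rw [div_lt_one (by positivity)]; linarith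
  have hb0 : 0 ≤ (s - 5) / (2 * (√2 + 2)) := div_nonneg (by linarith) (by positivity)
  refine exists_isRadius_ge hb0 hb1.le fun f hf r hr0 hr => ?_
  have hpos : ∀ w ∈ ball (1 : ℂ) (√2 - 1), 0 < w.re := by
    intro w hw
    have : (w : ℂ) ∈ ball ((1 : ℝ) : ℂ) (1 - (2 - √2)) := by
      rwa [Complex.ofReal_one, show (1 : ℝ) - (2 - √2) = √2 - 1 by ring]
    linarith [lt_re_of_mem_ball_ofReal this]
  refine dilate_mem_StarClass (ψ := fun w => w ^ 2 - 1) (Ω := ball 1 (√2 - 1)) (by fun_prop)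
    (by norm_num) ?_ ?_ hf hr0 (hr.le.trans hb1.le) fun z hz =>
      starQuot_mem_ball_one hf (by linarith) hb0 hb1 ?_ (hz.trans hr)
  · intro w hw
    rw [mem_ball_iff_norm] at hw
    have h1 : ‖w + 1‖ < √2 + 1 := by
      calc ‖w + 1‖ = ‖(w - 1) + 2‖ := by congr 1; ring
        _ ≤ ‖w - 1‖ + ‖(2 : ℂ)‖ := norm_add_le _ _
        _ < _ := by rw [Complex.norm_ofNat]; linarith
    simp only [mem_ball_zero_iff]
    rw [show w ^ 2 - 1 = (w - 1) * (w + 1) by ring, norm_mul]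
    nlinarith [norm_nonneg (w - 1), norm_nonneg (w + 1)]
  · intro w hw
    rw [phiL, add_sub_cancel, Complex.sq_cpow_half (hpos w hw)]
  · field_simp
    linear_combination (2 + √2) * hs2 - (4 * √2 + 8) * hq2

/-! ### The cardioid class -/

/-- Completing the square, φ(z) = 1/3 + (2/3)(z+1)², so m = 1/3 and the inverse is a square root. -/
theorem isSharpRadius_phiC :
    IsSharpRadius (StarClass phiC) ClassPi2 f3 ((15 - √217) / 2) := by
  have hs2 : √217 ^ 2 = 217 := Real.sq_sqrt (by norm_num)
  have h14 : 14 ≤ √217 := Real.le_sqrt_of_sq_le (by norm_num)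
  have h15 : √217 ≤ 15 := Real.sqrt_le_iff.mpr (by norm_num)
  have hq2 : √2 ^ 2 = 2 := Real.sq_sqrt (by norm_num)
  have hq : 1 < √2 := by rw [Real.lt_sqrt] <;> norm_num
  have hq' : √2 < 1.5 := by rw [Real.sqrt_lt'] <;> norm_num
  have hslit : ∀ w ∈ ball ((√2 : ℝ) : ℂ) (√2 - 1 / 3), (3 * w - 1) / 2 ∈ Complex.slitPlane := by
    intro w hw
    have hre := lt_re_of_mem_ball_ofReal hw
    left
    simp
    linarith
  refine isSharpRadius_StarClass (m := 1 / 3) (l := 0)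
    (ψ := fun w => ((3 * w - 1) / 2) ^ (1 / 2 : ℂ) - 1) (by norm_num) (by norm_num)
    (by linarith) (by linarith) (by linear_combination hs2 / 12) ?_ (by norm_num) ?_ ?_
    (by norm_num) ?_
  · intro w hw
    have : DifferentiableAt ℂ (fun w : ℂ => ((3 * w - 1) / 2) ^ (1 / 2 : ℂ)) w :=
      DifferentiableAt.cpow_const (by fun_prop) (hslit w hw)
    exact (this.sub_const 1).differentiableWithinAt
  · intro w hw
    have hspos := Complex.cpow_half_re_pos (hslit w hw)
    have hsq := Complex.cpow_half_sq ((3 * w - 1) / 2)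
    set s := ((3 * w - 1) / 2) ^ (1 / 2 : ℂ)
    have hre := lt_re_of_mem_ball_ofReal hw
    rw [mem_ball_ofReal_iff (by linarith)] at hw
    have h3 := congrArg Complex.re hsq
    have h4 := congrArg Complex.im hsq
    simp [sq] at h3 h4
    rw [mem_ball_zero_iff, ← norm_one (α := ℂ)]
    apply Complex.norm_lt_norm_of_re_im
    simp
    have hx : w.re = (2 * (s.re * s.re - s.im * s.im) + 1) / 3 := by linarith
    have hy : w.im = (2 * (s.re * s.im + s.im * s.re)) / 3 := by linarith
    have hA : 0 < s.re * s.re - s.im * s.im := by linarith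
    rw [hx, hy] at hw
    -- The goal |s - 1| < 1 means |s|² < 2 Re s. In s² = (3w-1)/2 the disk passes through 0 and
    -- reads |s|⁴ < (3√2 - 1) Re s², where 3√2 - 1 < 4.
    have h5 : (s.re ^ 2 + s.im ^ 2) ^ 2 < (2 * s.re) ^ 2 := by
      have : (s.re ^ 2 + s.im ^ 2) ^ 2 < (3 * √2 - 1) * (s.re * s.re - s.im * s.im) := by
        nlinarith
      nlinarith [mul_pos (by linarith : 0 < 4 - (3 * √2 - 1)) hA]
    have h6 := lt_of_pow_lt_pow_left₀ 2 (by positivity) h5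
    linarith
  · intro w hw
    have hsq := Complex.cpow_half_sq ((3 * w - 1) / 2)
    rw [phiC]
    linear_combination 2 / 3 * hsq
  · intro v hv z hz h
    have h3 := congrArg Complex.re h
    have h4 := congrArg Complex.im h
    have hzn : |z.re| < 1 := (Complex.abs_re_le_norm z).trans_lt (by simpa using hz)
    rw [abs_lt] at hzn
    simp [phiC, sq] at h3 h4
    have hv2 := hv.2
    have : z.im * (z.re + 1) = 0 := by linarith
    rcases mul_eq_zero.mp this with h5 | h5
    · rw [h5] at h3; nlinarith [sq_nonneg (z.re + 1)]
    · linarith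

/-! ### The lune class -/

/-- Squaring w - z = √(1+z²) gives w - 1/w = 2z, which determines z. A real value v in (0, √2 - 1)
would force |z| = (1-v²)/(2v) > 1. -/
theorem isSharpRadius_phiMoon :
    IsSharpRadius (StarClass phiMoon) ClassPi2 f3
      ((5 - √(41 - 12 * √2)) / (2 * (√2 - 1))) := by
  have hq2 : √2 ^ 2 = 2 := Real.sq_sqrt (by norm_num)
  have hq : 1.41 < √2 := by rw [Real.lt_sqrt] <;> norm_num
  have hq' : √2 < 1.42 := by rw [Real.sqrt_lt'] <;> norm_num
  set s := √(41 - 12 * √2) with hs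
  have hs2 : s ^ 2 = 41 - 12 * √2 := Real.sq_sqrt (by linarith)
  have h4 : 4.8 ≤ s := Real.le_sqrt_of_sq_le (by linarith)
  have h5 : s ≤ 5 := Real.sqrt_le_iff.mpr ⟨by norm_num, by linarith⟩
  have hd : 0 < √2 - 1 := by linarith
  have hpos : ∀ w ∈ ball ((√2 : ℝ) : ℂ) (√2 - (√2 - 1)), 0 < w.re :=
    fun w hw => hd.trans (lt_re_of_mem_ball_ofReal hw)
  have hne : ∀ w ∈ ball ((√2 : ℝ) : ℂ) (√2 - (√2 - 1)), w ≠ 0 := by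
    rintro w hw rfl
    simpa using hpos 0 hw
  refine isSharpRadius_StarClass (m := √2 - 1) (l := 0) (ψ := fun w => (w - w⁻¹) / 2) hd.le
    (by linarith) (div_nonneg (by linarith) (by linarith)) ?_ ?_ ?_ (by simp) ?_ ?_ hd ?_
  · rw [div_lt_one (by linarith)]; linarith
  · field_simp
    linear_combination hs2 - 4 * hq2
  · exact (differentiableOn_id.sub (differentiableOn_id.inv hne)).div_const 2
  · intro w hw
    have hn := hne w hw
    rw [mem_ball_ofReal_iff (by linarith)] at hw
    have hx := hpos w (by rw [mem_ball_ofReal_iff (by linarith)]; exact hw)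
    have e : (w - w⁻¹) / 2 = (w ^ 2 - 1) / (2 * w) := by field_simp
    simp only [mem_ball_zero_iff]
    rw [e, norm_div, div_lt_one (norm_pos_iff.mpr (by simpa using hn))]
    apply Complex.norm_lt_norm_of_re_im
    simp [sq]
    -- The disk reads |w|² + 1 < 2√2 Re w, and |w² - 1|² = (|w|² + 1)² - 4(Re w)².
    have h1 : (w.re ^ 2 + w.im ^ 2 + 1) ^ 2 < (2 * √2 * w.re) ^ 2 := by
      apply pow_lt_pow_left₀ _ (by positivity) (by norm_num)
      nlinarith
    rw [mul_pow, mul_pow, hq2] at h1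
    nlinarith
  · intro w hw
    have hn := hne w hw
    have hx := hpos w hw
    have e : 1 + ((w - w⁻¹) / 2) ^ 2 = ((w + w⁻¹) / 2) ^ 2 := by field_simp; ring
    have hre : 0 < ((w + w⁻¹) / 2).re := by
      simp
      have := Complex.normSq_pos.mpr hn
      positivity
    rw [phiMoon, e, Complex.sq_cpow_half hre]
    ring
  · rintro v ⟨hv1, hv2⟩ z hz h
    have hz1 : ‖z‖ < 1 := by simpa using hz
    have hsq := Complex.cpow_half_sq (1 + z ^ 2)
    rw [phiMoon] at h
    have hs' : (1 + z ^ 2) ^ (1 / 2 : ℂ) = v - z := by linear_combination h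
    rw [hs'] at hsq
    have h2 : ((2 * v : ℝ) : ℂ) * z = ((v ^ 2 - 1 : ℝ) : ℂ) := by
      push_cast; linear_combination -hsq
    have h3 := congrArg norm h2
    rw [norm_mul, Complex.norm_real, Complex.norm_real, Real.norm_eq_abs, Real.norm_eq_abs,
      abs_of_pos (by linarith), abs_of_neg (by nlinarith)] at h3
    nlinarith [norm_nonneg z]

/-! ### The rational class -/

/-- Solving φ(z) = w gives a quadratic in z with discriminant k²(w² + 4w - 4), whose roots in w are
±2√2 - 2; the larger one is m. With ζ the quotient of the two linear factors and T = √ζ, the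
solution becomes z = (3 + 2√2 - T)/(1 + T). -/
theorem isSharpRadius_phiR :
    IsSharpRadius (StarClass phiR) ClassPi2 f3
      ((5 - √(81 - 40 * √2)) / (4 * (√2 - 1))) := by
  have hq2 : √2 ^ 2 = 2 := Real.sq_sqrt (by norm_num)
  have hq : 1.41 < √2 := by rw [Real.lt_sqrt] <;> norm_num
  have hq' : √2 < 1.42 := by rw [Real.sqrt_lt'] <;> norm_num
  set s := √(81 - 40 * √2) with hs
  have hs2 : s ^ 2 = 81 - 40 * √2 := Real.sq_sqrt (by linarith)
  have h4 : 4.8 ≤ s := Real.le_sqrt_of_sq_le (by linarith)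
  have h5 : s ≤ 5 := Real.sqrt_le_iff.mpr ⟨by norm_num, by linarith⟩
  have hd : 0 < √2 - 1 := by linarith
  set q : ℂ := ((√2 : ℝ) : ℂ) with hqdef
  have hqq : q ^ 2 = 2 := by rw [hqdef]; exact_mod_cast hq2
  have hq0 : q ≠ 0 := by rw [hqdef]; exact_mod_cast (by linarith : √2 ≠ 0)
  have hqre : q.re = √2 := by simp [hqdef]
  have hqim : q.im = 0 := by simp [hqdef]
  have hk0 : q + 1 ≠ 0 := by
    intro h
    have := congrArg Complex.re h
    simp [hqre] at this
    linarith
  set Ω := ball q (√2 - (2 * √2 - 2)) with hΩ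
  have hre : ∀ w ∈ Ω, 2 * √2 - 2 < w.re := fun w hw => lt_re_of_mem_ball_ofReal hw
  have hne : ∀ w ∈ Ω, w - (2 * q - 2) ≠ 0 := by
    intro w hw h
    have := congrArg Complex.re h
    have h2 := hre w hw
    simp [hqre] at this
    linarith
  set ζ : ℂ → ℂ := fun w => (w + (2 * q + 2)) / (w - (2 * q - 2)) with hζ
  -- The pole of ζ lies on the boundary of Ω, so Ω goes to a half-plane; its edge is ζ(2) = (√2 +
  -- 1)². Hence Re T > √2 + 1, which is exactly |3 + 2√2 - T| < |1 + T|.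
  have hζre : ∀ w ∈ Ω, 3 + 2 * √2 < (ζ w).re := by
    intro w hw
    have hn := hne w hw
    have h2 := hre w hw
    have e : ζ w = 1 + ((4 * √2 : ℝ) : ℂ) * (w - (2 * q - 2))⁻¹ := by
      simp only [hζ]
      push_cast
      rw [← hqdef]
      rw [div_eq_iff hn, add_mul, mul_assoc, inv_mul_cancel₀ hn]
      ring
    have hw' := (mem_ball_ofReal_iff (by linarith)).mp hw
    rw [e, Complex.add_re, Complex.re_ofReal_mul, Complex.inv_re, Complex.one_re]
    have hN : Complex.normSq (w - (2 * q - 2)) < 2 * (2 - √2) * (w - (2 * q - 2)).re := by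
      rw [Complex.normSq_apply]
      simp [hqre, hqim]
      nlinarith
    have hNp := Complex.normSq_pos.mpr hn
    have hgt : 1 / (2 * (2 - √2)) < (w - (2 * q - 2)).re / Complex.normSq (w - (2 * q - 2)) := by
      rw [div_lt_div_iff₀ (by linarith) hNp]
      linarith
    have hval : 2 + 2 * √2 = 4 * √2 * (1 / (2 * (2 - √2))) := by
      have : 2 - √2 ≠ 0 := by linarith
      field_simp
      linear_combination -4 * hq2
    have := mul_lt_mul_of_pos_left hgt (by linarith : 0 < 4 * √2)
    linarith
  have hslit : ∀ w ∈ Ω, ζ w ∈ Complex.slitPlane := fun w hw => Or.inl (by linarith [hζre w hw])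
  have hTre : ∀ w ∈ Ω, √2 + 1 < ((ζ w) ^ (1 / 2 : ℂ)).re := by
    intro w hw
    have h1 := Complex.cpow_half_re_pos (hslit w hw)
    have h2 := congrArg Complex.re (Complex.cpow_half_sq (ζ w))
    have h3 := hζre w hw
    rw [← h2] at h3
    simp only [sq, Complex.mul_re] at h3
    refine lt_of_pow_lt_pow_left₀ 2 h1.le ?_
    nlinarith [mul_self_nonneg ((ζ w) ^ (1 / 2 : ℂ)).im]
  have hne' : ∀ w ∈ Ω, 1 + (ζ w) ^ (1 / 2 : ℂ) ≠ 0 := by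
    intro w hw h
    have := congrArg Complex.re h
    have h2 := hTre w hw
    rw [Complex.add_re, Complex.one_re, Complex.zero_re] at this
    linarith
  have hk : ((√2 + 1 : ℝ) : ℂ) = q + 1 := by push_cast; rfl
  refine isSharpRadius_StarClass (m := 2 * √2 - 2) (l := 0)
    (ψ := fun w => (4 + 2 * q) / (1 + (ζ w) ^ (1 / 2 : ℂ)) - 1) (by linarith)
    (by linarith) (div_nonneg (by linarith) (by linarith)) ?_ ?_ ?_ ?_ ?_ ?_ (by linarith) ?_
  · rw [div_lt_one (by linarith)]; linarith
  · field_simp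
    linear_combination 2 * hs2 - 32 * hq2
  · intro w hw
    have hζd : DifferentiableAt ℂ ζ w :=
      DifferentiableAt.div (by fun_prop) (by fun_prop) (hne w hw)
    exact (((differentiableAt_const _).div ((hζd.cpow_const (hslit w hw)).const_add 1)
      (hne' w hw)).sub_const 1).differentiableWithinAt
  · have h1Ω : (1 : ℂ) ∈ Ω := one_mem_ball_sqrt_two (by linarith)
    have e : ζ 1 = (3 + 2 * q) ^ 2 := by
      simp only [hζ]
      rw [div_eq_iff (hne 1 h1Ω)]
      linear_combination (12 + 8 * q) * hqq
    simp only [e]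
    rw [Complex.sq_cpow_half (by simp [hqre]; linarith)]
    rw [sub_eq_zero, div_eq_one_iff_eq]
    · ring
    · intro h
      have := congrArg Complex.re h
      simp [hqre] at this
      linarith
  · intro w hw
    have hn := hne' w hw
    have h2 := hTre w hw
    have e : (4 + 2 * q) / (1 + (ζ w) ^ (1 / 2 : ℂ)) - 1
        = ((4 + 2 * q) - (1 + (ζ w) ^ (1 / 2 : ℂ))) / (1 + (ζ w) ^ (1 / 2 : ℂ)) := by
      field_simp
    simp only [mem_ball_zero_iff]
    rw [e, norm_div, div_lt_one (norm_pos_iff.mpr hn)]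
    generalize (ζ w) ^ (1 / 2 : ℂ) = T at *
    apply Complex.norm_lt_norm_of_re_im
    simp [hqre, hqim]
    nlinarith
  · intro w hw
    have hn := hne' w hw
    have hre := hTre w hw
    have hsq := Complex.cpow_half_sq (ζ w)
    have hn2 := hne w hw
    simp only [hζ] at hsq
    rw [eq_div_iff hn2] at hsq
    change phiR ((4 + 2 * q) / (1 + (ζ w) ^ (1 / 2 : ℂ)) - 1) = w
    simp only [phiR, hk]
    simp only [hζ] at hn hre ⊢
    generalize ((w + (2 * q + 2)) / (w - (2 * q - 2))) ^ (1 / 2 : ℂ) = T at *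
    have hT1 : T - 1 ≠ 0 := by
      intro h
      have := congrArg Complex.re h
      rw [Complex.sub_re, Complex.one_re, Complex.zero_re] at this
      linarith
    have e1 : (q + 1) ^ 2 - (q + 1) * ((4 + 2 * q) / (1 + T) - 1)
        = q * (q + 1) ^ 2 * (T - 1) / (1 + T) := by
      field_simp
      linear_combination (1 - T) * hqq
    have e2 : (q + 1) * ((4 + 2 * q) / (1 + T) - 1) + ((4 + 2 * q) / (1 + T) - 1) ^ 2
        = ((q + 1) * (3 + 2 * q - T) * (1 + T) + (3 + 2 * q - T) ^ 2) / (1 + T) ^ 2 := by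
      field_simp
      ring
    have key : (w - 1) * (q * (q + 1) ^ 2 * (T ^ 2 - 1))
        = (q + 1) * (3 + 2 * q - T) * (1 + T) + (3 + 2 * q - T) ^ 2 := by
      linear_combination (q * (q + 1) ^ 2) * hsq
        + ((2 * q ^ 2 + q) * T ^ 2 - 2 * T + 2 * q ^ 2 + 7 * q + 6) * hqq
    have e3 : q * (q + 1) ^ 2 * (T - 1) / (1 + T) * (1 + T) ^ 2
        = q * (q + 1) ^ 2 * (T ^ 2 - 1) := by
      field_simp
      ring
    have hne3 : q * (q + 1) ^ 2 * (T - 1) / (1 + T) ≠ 0 :=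
      div_ne_zero (mul_ne_zero (mul_ne_zero hq0 (pow_ne_zero 2 hk0)) hT1) hn
    rw [e1, e2, ← eq_sub_iff_add_eq', div_eq_iff hne3, div_eq_iff (pow_ne_zero 2 hn)]
    linear_combination -key - (w - 1) * e3
  · rintro v ⟨hv1, hv2⟩ z hz h
    have hzn : ‖z‖ ^ 2 < 1 := by
      have : ‖z‖ < 1 := by simpa using hz
      nlinarith [norm_nonneg z]
    have hden : (q + 1) ^ 2 - (q + 1) * z ≠ 0 := by
      intro h
      have h1 : (q + 1) * (q + 1 - z) = 0 := by linear_combination h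
      rcases mul_eq_zero.mp h1 with h2 | h2
      · exact hk0 h2
      · have := congrArg Complex.re h2
        have h3 := (Complex.re_le_norm z)
        simp [hqre] at this
        nlinarith
    simp only [phiR, hk] at h
    rw [← eq_sub_iff_add_eq', div_eq_iff hden] at h
    rw [Complex.sq_norm, Complex.normSq_apply] at hzn
    have h3 := congrArg Complex.re h
    have h4 := congrArg Complex.im h
    simp [sq, hqre, hqim] at h3 h4
    have h6 : z.im * (2 * z.re + v * (√2 + 1)) = 0 := by linear_combination h4
    have hv : v ^ 2 + 4 * v - 4 < 0 := by nlinarith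
    -- A real z makes a square equal to k²(v² + 4v - 4) < 0. Otherwise |z|² = k²(1 - v) > k²(3 -
    -- 2√2) = 1.
    rcases mul_eq_zero.mp h6 with h7 | h7
    · rw [h7] at h3
      have : (2 * z.re + v * (√2 + 1)) ^ 2 = (√2 + 1) ^ 2 * (v ^ 2 + 4 * v - 4) := by
        linear_combination 4 * h3
      nlinarith [sq_nonneg (2 * z.re + v * (√2 + 1)), mul_neg_of_pos_of_neg (by positivity : 0 < (√2 + 1) ^ 2) hv]
    · have : z.re * z.re + z.im * z.im = (√2 + 1) ^ 2 * (1 - v) := by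
        linear_combination -h3 + z.re * h7
      have h8 : (√2 + 1) ^ 2 * (1 - (2 * √2 - 2)) = 1 := by
        linear_combination (-1 - 2 * √2) * hq2
      nlinarith [mul_lt_mul_of_pos_left hv2 (by positivity : 0 < (√2 + 1) ^ 2)]

/-! ### The sine class -/

theorem Complex.norm_sin_sq (z : ℂ) :
    ‖Complex.sin z‖ ^ 2 = Real.sin z.re ^ 2 + Real.sinh z.im ^ 2 := by
  have h : Complex.sin z = ((Real.sin z.re * Real.cosh z.im : ℝ) : ℂ)
      + ((Real.cos z.re * Real.sinh z.im : ℝ) : ℂ) * Complex.I := by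
    push_cast
    exact Complex.sin_eq z
  rw [h, Complex.sq_norm, Complex.normSq_add_mul_I]
  have h1 := Real.cosh_sq z.im
  have h2 := Real.sin_sq_add_cos_sq z.re
  rw [mul_pow, mul_pow, h1]
  linear_combination Real.sinh z.im ^ 2 * h2

/-- This puts the arcsine of the disk |u| < sin 1 inside 𝔻. It follows from sinh² y ≥ y² and sin² 1
- sin² x = sin(1-x) sin(1+x) ≤ 1 - x². -/
theorem sq_add_sq_lt_one_of_sin_sq_add_sinh_sq_lt {x y : ℝ} (hx : |x| ≤ Real.pi / 2)
    (h : Real.sin x ^ 2 + Real.sinh y ^ 2 < Real.sin 1 ^ 2) : x ^ 2 + y ^ 2 < 1 := by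
  have hpi := Real.pi_gt_three
  have hs1 : 0 < Real.sin 1 := Real.sin_pos_of_pos_of_lt_pi one_pos (by linarith)
  have hx1 : |x| < 1 := by
    by_contra! hc
    have h1 : Real.sin 1 ≤ Real.sin |x| :=
      Real.sin_le_sin_of_le_of_le_pi_div_two (by linarith) hx hc
    have h2 : Real.sin |x| ^ 2 = Real.sin x ^ 2 := by
      rcases abs_choice x with h | h <;> simp [h]
    nlinarith [sq_nonneg (Real.sinh y)]
  have hy : y ^ 2 ≤ Real.sinh y ^ 2 := by
    rw [sq_le_sq, Real.abs_sinh]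
    exact Real.self_le_sinh_iff.mpr (abs_nonneg y)
  rw [abs_lt] at hx1
  have hprod : Real.sin 1 ^ 2 - Real.sin x ^ 2 = Real.sin (1 - x) * Real.sin (1 + x) := by
    rw [Real.sin_sub, Real.sin_add]
    have h1 := Real.sin_sq_add_cos_sq x
    have h2 := Real.sin_sq_add_cos_sq 1
    linear_combination Real.sin x ^ 2 * h2 - Real.sin 1 ^ 2 * h1
  have hle : Real.sin (1 - x) * Real.sin (1 + x) ≤ (1 - x) * (1 + x) :=
    mul_le_mul (Real.sin_le (by linarith)) (Real.sin_le (by linarith))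
      (Real.sin_nonneg_of_nonneg_of_le_pi (by linarith) (by linarith)) (by linarith)
  nlinarith

/-- A branch of the complex arcsine on the unit disk. -/
theorem exists_analytic_arcsin : ∃ S : ℂ → ℂ, DifferentiableOn ℂ S (ball 0 1) ∧ S 0 = 0 ∧
    ∀ u ∈ ball (0 : ℂ) 1, Complex.sin (S u) = u ∧ |(S u).re| ≤ Real.pi / 2 := by
  have hslit : ∀ u ∈ ball (0 : ℂ) 1, 1 - u ^ 2 ∈ Complex.slitPlane := by
    intro u hu
    left
    have h1 : ‖u ^ 2‖ < 1 := by
      rw [norm_pow]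
      exact pow_lt_one₀ (norm_nonneg u) (by simpa using hu) two_ne_zero
    have h2 := Complex.re_le_norm (u ^ 2)
    rw [Complex.sub_re, Complex.one_re]
    linarith
  -- This is exp(i arcsin u). Since e + 1/e = 2√(1-u²) has positive real part, and Re(1/e) has the
  -- sign of Re e, also Re e > 0, so the logarithm is analytic along it.
  set e : ℂ → ℂ := fun u => (1 - u ^ 2) ^ (1 / 2 : ℂ) + Complex.I * u with he
  have hprod : ∀ u, e u * ((1 - u ^ 2) ^ (1 / 2 : ℂ) - Complex.I * u) = 1 := by
    intro u
    have h1 := Complex.cpow_half_sq (1 - u ^ 2)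
    have h2 := Complex.I_sq
    simp only [he]
    linear_combination h1 - u ^ 2 * h2
  have hpos : ∀ u ∈ ball (0 : ℂ) 1, 0 < (e u).re := by
    intro u hu
    have h1 := Complex.cpow_half_re_pos (hslit u hu)
    have h0 : e u ≠ 0 := left_ne_zero_of_mul_eq_one (hprod u)
    have h2 : e u + (e u)⁻¹ = 2 * (1 - u ^ 2) ^ (1 / 2 : ℂ) := by
      rw [inv_eq_of_mul_eq_one_right (hprod u)]
      simp only [he]
      ring
    have h3 := congrArg Complex.re h2
    rw [Complex.add_re, Complex.inv_re] at h3
    have hN := Complex.normSq_pos.mpr h0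
    by_contra! hc
    have h4 : (e u).re / Complex.normSq (e u) ≤ 0 := div_nonpos_of_nonpos_of_nonneg hc hN.le
    simp at h3 h1
    linarith
  refine ⟨fun u => -Complex.I * Complex.log (e u), ?_, by simp [he], fun u hu => ⟨?_, ?_⟩⟩
  · intro u hu
    have h0 : DifferentiableAt ℂ (fun u : ℂ => 1 - u ^ 2) u := by fun_prop
    have h1 : DifferentiableAt ℂ e u := (h0.cpow_const (hslit u hu)).add (by fun_prop)
    exact ((h1.clog (Or.inl (hpos u hu))).const_mul _).differentiableWithinAt
  · have h0 : e u ≠ 0 := left_ne_zero_of_mul_eq_one (hprod u)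
    have hI : Complex.I * Complex.I = -1 := Complex.I_mul_I
    have e1 : -(-Complex.I * Complex.log (e u)) * Complex.I = -Complex.log (e u) := by
      linear_combination Complex.log (e u) * hI
    have e2 : -Complex.I * Complex.log (e u) * Complex.I = Complex.log (e u) := by
      linear_combination -Complex.log (e u) * hI
    rw [Complex.sin, e1, e2, Complex.exp_neg, Complex.exp_log h0,
      inv_eq_of_mul_eq_one_right (hprod u)]
    simp only [he]
    linear_combination -u * hI
  · have : (-Complex.I * Complex.log (e u)).re = (e u).arg := by simp [Complex.log_im]
    rw [this]
    exact (Complex.abs_arg_lt_pi_div_two_iff.mpr (Or.inl (hpos u hu))).le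

theorem exists_isRadius_phiSin :
    ∃ R : ℝ, IsRadius (StarClass phiSin) ClassPi2 R ∧
      (√(25 + 4 * (3 + Real.sin 1) * Real.sin 1) - 5) / (2 * (3 + Real.sin 1)) ≤ R := by
  have hs0 : 0 < Real.sin 1 :=
    Real.sin_pos_of_pos_of_lt_pi one_pos (by linarith [Real.pi_gt_three])
  have hs1 : Real.sin 1 < 1 := Real.sin_lt one_pos
  set σ := Real.sin 1 with hσ
  set s := √(25 + 4 * (3 + σ) * σ) with hs
  have hs2 : s ^ 2 = 25 + 4 * (3 + σ) * σ := Real.sq_sqrt (by positivity)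
  have h5 : 5 ≤ s := Real.le_sqrt_of_sq_le (by nlinarith)
  have h11 : s ≤ 7 := Real.sqrt_le_iff.mpr ⟨by norm_num, by nlinarith⟩
  have hb1 : (s - 5) / (2 * (3 + σ)) < 1 := by rw [div_lt_one (by positivity)]; linarith
  have hb0 : 0 ≤ (s - 5) / (2 * (3 + σ)) := div_nonneg (by linarith) (by positivity)
  obtain ⟨S, hSd, hS0, hS⟩ := exists_analytic_arcsin
  have hsub : ∀ w ∈ ball (1 : ℂ) σ, w - 1 ∈ ball (0 : ℂ) 1 := by
    intro w hw
    rw [mem_ball_iff_norm] at hw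
    simpa using hw.trans hs1
  refine exists_isRadius_ge hb0 hb1.le fun f hf r hr0 hr =>
    dilate_mem_StarClass (ψ := fun w => S (w - 1)) (Ω := ball 1 σ)
      (hSd.comp (by fun_prop) hsub) (by simp [hS0]) (fun w hw => ?_)
      (fun w hw => by simp [phiSin, (hS _ (hsub w hw)).1]) hf hr0 (hr.le.trans hb1.le)
      fun z hz => ?_
  · have h1 := hS _ (hsub w hw)
    have h2 := Complex.norm_sin_sq (S (w - 1))
    rw [h1.1] at h2
    rw [mem_ball_iff_norm] at hw
    have h3 := sq_add_sq_lt_one_of_sin_sq_add_sinh_sq_lt (y := (S (w - 1)).im) h1.2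
      (by rw [← h2]; exact pow_lt_pow_left₀ hw (norm_nonneg _) two_ne_zero)
    rw [mem_ball_zero_iff, ← norm_one (α := ℂ)]
    apply Complex.norm_lt_norm_of_re_im
    simpa using h3
  -- Here M is φ(1) = 1 + sin 1.
  · have h := starQuot_mem_ball_one (M := 1 + σ) hf (by linarith) hb0 hb1 ?_ (hz.trans hr)
    · simpa using h
    · field_simp
      linear_combination (3 + σ) * hs2

/-! ### The exponential class -/

theorem Real.sinh_le_mul_cosh {c : ℝ} (hc : 0 ≤ c) : Real.sinh c ≤ c * Real.cosh c := by
  have hd : ∀ x, HasDerivAt (fun x => x * Real.cosh x - Real.sinh x) (x * Real.sinh x) x := by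
    intro x
    have := ((hasDerivAt_id x).mul (Real.hasDerivAt_cosh x)).sub (Real.hasDerivAt_sinh x)
    refine this.congr_deriv ?_
    simp
  have hm : MonotoneOn (fun x => x * Real.cosh x - Real.sinh x) (Set.Ici 0) := by
    refine monotoneOn_of_deriv_nonneg (convex_Ici 0)
      (fun x _ => (hd x).continuousAt.continuousWithinAt)
      (fun x _ => (hd x).differentiableAt.differentiableWithinAt) fun x hx => ?_
    rw [(hd x).deriv]
    rw [interior_Ici] at hx
    exact mul_nonneg (le_of_lt hx) (Real.sinh_nonneg_iff.mpr (le_of_lt hx))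
  have := hm (Set.mem_Ici.mpr le_rfl) (Set.mem_Ici.mpr hc) hc
  simpa using this

theorem Real.mul_cos_le_sin {s : ℝ} (h0 : 0 ≤ s) (h1 : s < Real.pi / 2) :
    s * Real.cos s ≤ Real.sin s := by
  have hc : 0 < Real.cos s := Real.cos_pos_of_mem_Ioo ⟨by linarith [Real.pi_pos], h1⟩
  have := Real.le_tan h0 h1
  rwa [Real.tan_eq_sin_div_cos, le_div_iff₀ hc] at this

/-- The quotient is cosh x / cos y along the unit circle x + iy = exp(iθ). The derivative is
nonnegative by sinh c ≤ c cosh c and s cos s ≤ sin s, so the minimum on the quarter circle is cosh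
1, at θ = 0. -/
theorem monotoneOn_cosh_cos_div_cos_sin :
    MonotoneOn (fun θ => Real.cosh (Real.cos θ) / Real.cos (Real.sin θ))
      (Set.Icc 0 (Real.pi / 2)) := by
  have hpi := Real.pi_gt_three
  have hcpos : ∀ θ, 0 < Real.cos (Real.sin θ) := fun θ =>
    Real.cos_pos_of_mem_Ioo ⟨by linarith [Real.neg_one_le_sin θ], by linarith [Real.sin_le_one θ]⟩
  have hd : ∀ θ, HasDerivAt (fun θ => Real.cosh (Real.cos θ) / Real.cos (Real.sin θ))
      ((Real.sinh (Real.cos θ) * -Real.sin θ * Real.cos (Real.sin θ)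
        - Real.cosh (Real.cos θ) * (-Real.sin (Real.sin θ) * Real.cos θ))
          / Real.cos (Real.sin θ) ^ 2) θ := fun θ =>
    (Real.hasDerivAt_cos θ).cosh.div (Real.hasDerivAt_sin θ).cos (hcpos θ).ne'
  refine monotoneOn_of_deriv_nonneg (convex_Icc _ _)
    (fun x _ => (hd x).continuousAt.continuousWithinAt)
    (fun x _ => (hd x).differentiableAt.differentiableWithinAt) fun θ hθ => ?_
  rw [interior_Icc] at hθ
  rw [(hd θ).deriv]
  have hs : 0 ≤ Real.sin θ :=
    Real.sin_nonneg_of_nonneg_of_le_pi hθ.1.le (by linarith [hθ.2])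
  have hc : 0 ≤ Real.cos θ := Real.cos_nonneg_of_mem_Icc ⟨by linarith [hθ.1], hθ.2.le⟩
  have h1 := Real.sinh_le_mul_cosh hc
  have h2 := Real.mul_cos_le_sin hs (by linarith [Real.sin_le_one θ])
  have h3 := mul_le_mul h1 h2 (mul_nonneg hs (hcpos θ).le)
    (mul_nonneg hc (Real.cosh_pos _).le)
  refine div_nonneg ?_ (by positivity)
  linarith

/-- With w = exp(x + iy) the hypothesis says that w lies in the disk with diameter (1/e, e), so
`Complex.log` maps that disk into 𝔻. A point outside with |x| < 1 is compared with the point of the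
unit circle having the same |x|. -/
theorem sq_add_sq_lt_one_of_cosh_lt {x y : ℝ} (hy : |y| ≤ Real.pi / 2)
    (h : Real.cosh x < Real.cosh 1 * Real.cos y) : x ^ 2 + y ^ 2 < 1 := by
  have hpi := Real.pi_gt_three
  by_contra! hc
  have hx : |x| < 1 := by
    by_contra! hx
    have h1 : Real.cosh 1 ≤ Real.cosh x := by
      rw [Real.cosh_le_cosh, abs_one]; exact hx
    nlinarith [Real.cos_le_one y, Real.cosh_pos (1 : ℝ)]
  set θ := Real.arccos |x| with hθ
  have hcos : Real.cos θ = |x| := Real.cos_arccos (by linarith [abs_nonneg x]) hx.le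
  have hsin : Real.sin θ = √(1 - |x| ^ 2) := Real.sin_arccos _
  have hθ0 : 0 ≤ θ := Real.arccos_nonneg _
  have hθ1 : θ ≤ Real.pi / 2 := Real.arccos_le_pi_div_two.mpr (abs_nonneg x)
  have hm := monotoneOn_cosh_cos_div_cos_sin (Set.mem_Icc.mpr ⟨le_rfl, by linarith⟩)
    (Set.mem_Icc.mpr ⟨hθ0, hθ1⟩) hθ0
  have hcpos : 0 < Real.cos (Real.sin θ) :=
    Real.cos_pos_of_mem_Ioo ⟨by linarith [Real.neg_one_le_sin θ], by linarith [Real.sin_le_one θ]⟩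
  simp only [Real.cos_zero, Real.sin_zero, div_one] at hm
  rw [le_div_iff₀ hcpos, hcos, Real.cosh_abs] at hm
  have hle : Real.sin θ ≤ |y| := by
    rw [hsin]
    refine Real.sqrt_le_iff.mpr ⟨abs_nonneg y, ?_⟩
    rw [sq_abs, sq_abs]
    linarith
  have hs0 : 0 ≤ Real.sin θ := by rw [hsin]; exact Real.sqrt_nonneg _
  have hcy : Real.cos y ≤ Real.cos (Real.sin θ) := by
    rw [← Real.cos_abs y]
    exact Real.cos_le_cos_of_nonneg_of_le_pi hs0 (by linarith) hle
  nlinarith [Real.cosh_pos (1 : ℝ)]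

theorem isSharpRadius_phiE :
    IsSharpRadius (StarClass phiE) ClassPi2 f3
      (2 * (Real.exp 1 - 1) /
        (5 * Real.exp 1 + √(25 * Real.exp 1 ^ 2 - 4 * Real.exp 1 + 4))) := by
  have he1 := Real.exp_one_gt_d9
  have he2 := Real.exp_one_lt_d9
  have hq2 : √2 ^ 2 = 2 := Real.sq_sqrt (by norm_num)
  have hq : 1 < √2 := by rw [Real.lt_sqrt] <;> norm_num
  have hq' : √2 < 1.42 := by rw [Real.sqrt_lt'] <;> norm_num
  set e := Real.exp 1 with he
  have he0 : 0 < e := by linarith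
  have hm : e⁻¹ < 1 := inv_lt_one_of_one_lt₀ (by linarith)
  have hm3 : 1 / 3 < e⁻¹ := by
    rw [one_div]; exact inv_strictAnti₀ he0 (by linarith)
  have hm0 : 0 < e⁻¹ := by positivity
  have hee : e * e⁻¹ = 1 := mul_inv_cancel₀ he0.ne'
  set s := √(25 * e ^ 2 - 4 * e + 4) with hs
  have hs2 : s ^ 2 = 25 * e ^ 2 - 4 * e + 4 := Real.sq_sqrt (by nlinarith)
  have hs0 : 0 ≤ s := Real.sqrt_nonneg _
  have hpos : ∀ w ∈ ball ((√2 : ℝ) : ℂ) (√2 - e⁻¹), 0 < w.re :=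
    fun w hw => hm0.trans (lt_re_of_mem_ball_ofReal hw)
  have hne : ∀ w ∈ ball ((√2 : ℝ) : ℂ) (√2 - e⁻¹), w ≠ 0 := by
    rintro w hw rfl
    simpa using hpos 0 hw
  refine isSharpRadius_StarClass (m := e⁻¹) (l := 0) (ψ := Complex.log) hm0.le hm
    (div_nonneg (by linarith) (by positivity)) ?_ ?_ ?_ Complex.log_one ?_
    (fun w hw => Complex.exp_log (hne w hw)) hm0 ?_
  · rw [div_lt_one (by positivity)]; linarith
  · field_simp
    linear_combination (e - 1) * hs2
  · exact fun w hw => (Complex.differentiableAt_log (Or.inl (hpos w hw))).differentiableWithinAt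
  · intro w hw
    have hx := hpos w hw
    have hn := hne w hw
    have hre := lt_re_of_mem_ball_ofReal hw
    have hw' := (mem_ball_ofReal_iff (by linarith)).mp hw
    have harg := (Complex.abs_arg_lt_pi_div_two_iff.mpr (Or.inl hx)).le
    have hwr : w.re = Real.exp (Complex.log w).re * Real.cos w.arg := by
      conv_lhs => rw [← Complex.exp_log hn]
      rw [Complex.exp_re, Complex.log_im]
    have hN : w.re ^ 2 + w.im ^ 2 = Real.exp (Complex.log w).re ^ 2 := by
      rw [Complex.log_re, Real.exp_log (norm_pos_iff.mpr hn), Complex.sq_norm,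
        Complex.normSq_apply]
      ring
    set x := (Complex.log w).re
    have hch : 2 * Real.cosh 1 = e + e⁻¹ := by
      rw [Real.cosh_eq, Real.exp_neg]; ring
    -- Since 2√2 < e + 1/e, the disk about √2 through 1/e lies in the disk with diameter (1/e, e).
    have hlt : Real.exp x ^ 2 + 1 < (e + e⁻¹) * w.re := by
      nlinarith [mul_pos (by linarith : 0 < e + e⁻¹ - 2 * √2) (sub_pos.mpr hre)]
    have hx0 := Real.exp_pos x
    have hcosh : Real.cosh x < Real.cosh 1 * Real.cos w.arg := by
      have h1 : 2 * Real.exp x * Real.cosh x = Real.exp x ^ 2 + 1 := by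
        rw [Real.cosh_eq, Real.exp_neg]; field_simp
      rw [← h1, ← hch, hwr] at hlt
      refine lt_of_mul_lt_mul_left (a := 2 * Real.exp x) ?_ (by positivity)
      linarith
    have h3 := sq_add_sq_lt_one_of_cosh_lt harg hcosh
    rw [mem_ball_zero_iff, ← norm_one (α := ℂ)]
    apply Complex.norm_lt_norm_of_re_im
    simpa [Complex.log_im] using h3
  · rintro v ⟨hv0, hv⟩ z hz h
    have h1 := congrArg norm h
    rw [phiE, Complex.norm_exp, Complex.norm_real, Real.norm_eq_abs, abs_of_pos hv0] at h1
    have h2 := (Complex.abs_re_le_norm z).trans_lt (by simpa using hz)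
    rw [← h1, he, ← Real.exp_neg, Real.exp_lt_exp] at hv
    rw [abs_lt] at h2
    linarith

/-! ### The parabolic class -/

/-- As cosh is even, the branch of the root is immaterial: across the cut the function is cos √(-ζ),
and the singularity at 0 is removable by continuity. -/
theorem Complex.differentiable_cosh_cpow_half :
    Differentiable ℂ fun ζ : ℂ => Complex.cosh (ζ ^ (1 / 2 : ℂ)) := by
  have hneg : ∀ ζ : ℂ, Complex.cosh (ζ ^ (1 / 2 : ℂ)) = Complex.cos ((-ζ) ^ (1 / 2 : ℂ)) := by
    intro ζ
    have h1 : (ζ ^ (1 / 2 : ℂ)) ^ 2 = ((-ζ) ^ (1 / 2 : ℂ) * Complex.I) ^ 2 := by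
      rw [mul_pow, Complex.cpow_half_sq, Complex.cpow_half_sq, Complex.I_sq]
      ring
    rcases sq_eq_sq_iff_eq_or_eq_neg.mp h1 with h | h
    · rw [h, Complex.cosh_mul_I]
    · rw [h, Complex.cosh_neg, Complex.cosh_mul_I]
  have hne : ∀ ζ : ℂ, ζ ≠ 0 →
      DifferentiableAt ℂ (fun ζ : ℂ => Complex.cosh (ζ ^ (1 / 2 : ℂ))) ζ := by
    intro ζ hζ
    by_cases hs : ζ ∈ Complex.slitPlane
    · exact (Complex.differentiableAt_cpow_half hs).ccosh
    · have hs' : -ζ ∈ Complex.slitPlane :=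
        (Complex.mem_slitPlane_or_neg_mem_slitPlane hζ).resolve_left hs
      rw [funext hneg]
      exact (DifferentiableAt.cpow_const (by fun_prop) hs').ccos
  intro ζ
  by_cases hζ : ζ = 0
  · subst hζ
    refine (Complex.analyticAt_of_differentiable_on_punctured_nhds_of_continuousAt
      ?_ ?_).differentiableAt
    · filter_upwards [self_mem_nhdsWithin] with ζ hζ using hne ζ hζ
    · refine Complex.continuous_cosh.continuousAt.comp ?_
      exact Complex.continuousAt_cpow_const_of_re_pos (Or.inl le_rfl) (by norm_num)
  · exact hne ζ hζ

theorem Complex.norm_sub_one_div_add_one_lt_one {c : ℂ} (hc : 0 < c.re) :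
    ‖(c - 1) / (c + 1)‖ < 1 := by
  have hne : c + 1 ≠ 0 := by
    intro h
    have := congrArg Complex.re h
    simp at this
    linarith
  rw [norm_div, div_lt_one (norm_pos_iff.mpr hne)]
  apply Complex.norm_lt_norm_of_re_im
  simp
  nlinarith

/-- The argument is tanh²(σ/2), and (1 + tanh(σ/2))/(1 - tanh(σ/2)) = exp σ. The other sign of the
root gives exp(-σ), and the square of the logarithm is the same. -/
theorem phiP_tanh_sq {σ : ℂ} (hσ : |σ.im| < Real.pi / 2) (hc : 0 < (Complex.cosh σ).re) :
    phiP ((Complex.cosh σ - 1) / (Complex.cosh σ + 1)) = 1 + 2 / (Real.pi : ℂ) ^ 2 * σ ^ 2 := by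
  rw [abs_lt] at hσ
  have hpi := Real.pi_pos
  set a := Complex.cosh (σ / 2)
  set b := Complex.sinh (σ / 2)
  have hab : a ^ 2 - b ^ 2 = 1 := Complex.cosh_sq_sub_sinh_sq _
  have hcosh : Complex.cosh σ = a ^ 2 + b ^ 2 := by
    rw [← Complex.cosh_two_mul]; congr 1; ring
  have hplus : a + b = Complex.exp (σ / 2) := Complex.cosh_add_sinh _
  have hminus : a - b = Complex.exp (-(σ / 2)) := Complex.cosh_sub_sinh _
  have ha : a ≠ 0 := by
    intro h
    rw [hcosh, h] at hc
    have : b ^ 2 = -1 := by rw [h] at hab; linear_combination -hab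
    rw [this] at hc
    norm_num at hc
  have hz : (Complex.cosh σ - 1) / (Complex.cosh σ + 1) = (b / a) ^ 2 := by
    have h1 : Complex.cosh σ - 1 = 2 * b ^ 2 := by rw [hcosh]; linear_combination hab
    have h2 : Complex.cosh σ + 1 = 2 * a ^ 2 := by rw [hcosh]; linear_combination -hab
    rw [h1, h2]
    field_simp
  have hp : a + b ≠ 0 := by rw [hplus]; exact Complex.exp_ne_zero _
  have hm : a - b ≠ 0 := by rw [hminus]; exact Complex.exp_ne_zero _
  have hq1 : (1 + b / a) / (1 - b / a) = Complex.exp σ := by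
    have h1 : Complex.exp σ = (a + b) / (a - b) := by
      rw [hplus, hminus, ← Complex.exp_sub]; congr 1; ring
    rw [h1, one_add_div ha, one_sub_div ha]
    field_simp
  have hq2 : (1 + -(b / a)) / (1 - -(b / a)) = Complex.exp (-σ) := by
    rw [Complex.exp_neg, ← hq1, inv_div, sub_neg_eq_add, ← sub_eq_add_neg]
  rw [phiP, hz]
  rcases sq_eq_sq_iff_eq_or_eq_neg.mp (Complex.cpow_half_sq ((b / a) ^ 2)) with h | h
  · rw [h, hq1, Complex.log_exp (by linarith) (by linarith)]
  · rw [h, hq2, Complex.log_exp (by simp; linarith) (by simp; linarith), neg_sq]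

theorem isSharpRadius_phiP : IsSharpRadius (StarClass phiP) ClassPi2 f3 (5 - 2 * √6) := by
  have hs2 : √6 ^ 2 = 6 := Real.sq_sqrt (by norm_num)
  have hs1 : 2.4 < √6 := by rw [Real.lt_sqrt] <;> norm_num
  have hs3 : √6 < 2.5 := by rw [Real.sqrt_lt'] <;> norm_num
  have hq2 : √2 ^ 2 = 2 := Real.sq_sqrt (by norm_num)
  have hq : 1.41 < √2 := by rw [Real.lt_sqrt] <;> norm_num
  have hq' : √2 < 1.42 := by rw [Real.sqrt_lt'] <;> norm_num
  have hpi := Real.pi_pos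
  have hpi0 : (Real.pi : ℂ) ≠ 0 := by exact_mod_cast hpi.ne'
  set ζ : ℂ → ℂ := fun w => ((Real.pi ^ 2 / 2 : ℝ) : ℂ) * (w - 1) with hζ
  set C : ℂ → ℂ := fun w => Complex.cosh (ζ w ^ (1 / 2 : ℂ)) with hC
  set Ω := ball ((√2 : ℝ) : ℂ) (√2 - 1 / 2) with hΩ
  have him : ∀ w ∈ Ω, |(ζ w ^ (1 / 2 : ℂ)).im| < Real.pi / 2 := by
    intro w hw
    have hre := lt_re_of_mem_ball_ofReal hw
    have hw' := (mem_ball_ofReal_iff (by linarith)).mp hw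
    -- The disk lies inside the parabola |w - 1| < Re w. For t² = ζ(w) this gives 2(Im t)² =
    -- (π²/2)(|w - 1| - Re w + 1) < π²/2.
    have hpar : ‖w - 1‖ < w.re := by
      refine lt_of_pow_lt_pow_left₀ 2 (by linarith) ?_
      rw [Complex.sq_norm, Complex.normSq_apply]
      simp
      nlinarith [mul_pos (sub_pos.mpr hre) (by linarith : 0 < w.re + 5 / 2 - 2 * √2)]
    have hsq := Complex.cpow_half_sq (ζ w)
    set t := ζ w ^ (1 / 2 : ℂ)
    have h1 : t.re ^ 2 + t.im ^ 2 = Real.pi ^ 2 / 2 * ‖w - 1‖ := by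
      have := congrArg norm hsq
      rw [norm_pow, Complex.sq_norm, Complex.normSq_apply, hζ, norm_mul, Complex.norm_real,
        Real.norm_eq_abs, abs_of_pos (by positivity)] at this
      linarith
    have h2 : t.re ^ 2 - t.im ^ 2 = Real.pi ^ 2 / 2 * (w.re - 1) := by
      have := congrArg Complex.re hsq
      rw [hζ, Complex.re_ofReal_mul, sq, Complex.mul_re, Complex.sub_re, Complex.one_re] at this
      linarith
    refine abs_lt_of_sq_lt_sq ?_ (by positivity)
    have : Real.pi ^ 2 / 2 * ‖w - 1‖ < Real.pi ^ 2 / 2 * w.re :=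
      mul_lt_mul_of_pos_left hpar (by positivity)
    nlinarith
  have hCre : ∀ w ∈ Ω, 0 < (C w).re := by
    intro w hw
    have h := abs_lt.mp (him w hw)
    simp only [hC]
    generalize ζ w ^ (1 / 2 : ℂ) = t at *
    rw [← Complex.re_add_im t, Complex.cosh_add, Complex.cosh_mul_I, Complex.sinh_mul_I,
      ← Complex.ofReal_cosh, ← Complex.ofReal_cos, ← Complex.ofReal_sinh, ← Complex.ofReal_sin]
    simp
    exact mul_pos (Real.cosh_pos _) (Real.cos_pos_of_mem_Ioo h)
  have hCd : Differentiable ℂ C :=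
    Complex.differentiable_cosh_cpow_half.comp (by fun_prop : Differentiable ℂ ζ)
  have hCne : ∀ w ∈ Ω, C w + 1 ≠ 0 := by
    intro w hw h
    have := congrArg Complex.re h
    have h2 := hCre w hw
    rw [Complex.add_re, Complex.one_re, Complex.zero_re] at this
    linarith
  refine isSharpRadius_StarClass (m := 1 / 2) (l := 0) (ψ := fun w => (C w - 1) / (C w + 1))
    (by norm_num) (by norm_num) (by linarith) (by linarith) (by linear_combination 2 * hs2) ?_ ?_
    ?_ ?_ (by norm_num) ?_
  · exact (hCd.differentiableOn.sub_const 1).div (hCd.differentiableOn.add_const 1) hCne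
  · simp [hC, hζ]
  · exact fun w hw => by simpa using Complex.norm_sub_one_div_add_one_lt_one (hCre w hw)
  · intro w hw
    have := phiP_tanh_sq (him w hw) (hCre w hw)
    rw [Complex.cpow_half_sq] at this
    refine this.trans ?_
    simp only [hζ]
    push_cast
    field_simp
    ring
  · rintro v ⟨-, hv⟩ z hz h
    have ht : z ^ (1 / 2 : ℂ) ∈ ball (0 : ℂ) 1 := by
      have h1 := congrArg norm (Complex.cpow_half_sq z)
      rw [norm_pow] at h1
      have hz1 : ‖z‖ < 1 := by simpa using hz
      rw [mem_ball_zero_iff]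
      nlinarith [norm_nonneg (z ^ (1 / 2 : ℂ))]
    rw [phiP] at h
    have hre := re_one_add_div_one_sub_pos ht
    set L := Complex.log ((1 + z ^ (1 / 2 : ℂ)) / (1 - z ^ (1 / 2 : ℂ))) with hL
    have him2 : |L.im| < Real.pi / 2 := by
      rw [hL, Complex.log_im]
      exact Complex.abs_arg_lt_pi_div_two_iff.mpr (Or.inl hre)
    -- For v < 1/2 this is below -π²/4, whereas |Im L| < π/2 forces Re L² > -π²/4.
    have hL2 : L ^ 2 = ((Real.pi ^ 2 / 2 * (v - 1) : ℝ) : ℂ) := by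
      push_cast
      field_simp at h ⊢
      linear_combination h
    have h3 := congrArg Complex.re hL2
    rw [Complex.ofReal_re, sq, Complex.mul_re] at h3
    have h4 := sq_lt_sq' (abs_lt.mp him2).1 (abs_lt.mp him2).2
    nlinarith [mul_self_nonneg L.re, sq_nonneg Real.pi, mul_pos (pow_pos hpi 2) (sub_pos.mpr hv)]

/-! ### Univalence -/

/-- The **Noshiro–Warschawski** theorem: a function whose derivative has positive real part on a
convex set is injective there. -/
theorem Convex.injOn_of_re_deriv_pos {s : Set ℂ} (hs : Convex ℝ s) {ψ ψ' : ℂ → ℂ}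
    (hd : ∀ z ∈ s, HasDerivAt ψ (ψ' z) z) (hpos : ∀ z ∈ s, 0 < (ψ' z).re) : Set.InjOn ψ s := by
  intro a ha b hb hab
  by_contra hne
  have hmem : ∀ t ∈ Set.Icc (0 : ℝ) 1, a + t * (b - a) ∈ s := by
    intro t ht
    have := hs.add_smul_sub_mem ha hb ht
    simpa using this
  -- Along the segment, Re(conj(b-a)·ψ) has derivative |b-a|² Re ψ' > 0.
  have hder : ∀ t ∈ Set.Icc (0 : ℝ) 1,
      HasDerivAt (fun t : ℝ => (conj (b - a) * ψ (a + t * (b - a))).re)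
        (conj (b - a) * (ψ' (a + t * (b - a)) * (b - a))).re t := by
    intro t ht
    have h1 : HasDerivAt (fun z : ℂ => conj (b - a) * ψ (a + z * (b - a)))
        (conj (b - a) * (ψ' (a + t * (b - a)) * (b - a))) (t : ℂ) := by
      refine HasDerivAt.const_mul _ (HasDerivAt.comp (t : ℂ) (hd _ (hmem t ht)) ?_)
      simpa using ((hasDerivAt_id (t : ℂ)).mul_const (b - a)).const_add a
    exact h1.real_of_complex
  have hnorm : 0 < Complex.normSq (b - a) :=
    Complex.normSq_pos.mpr (sub_ne_zero.mpr (Ne.symm hne))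
  have hmono : StrictMonoOn (fun t : ℝ => (conj (b - a) * ψ (a + t * (b - a))).re)
      (Set.Icc 0 1) := by
    refine strictMonoOn_of_deriv_pos (convex_Icc 0 1)
      (fun t ht => (hder t ht).continuousAt.continuousWithinAt) fun t ht => ?_
    have ht' := interior_subset ht
    rw [(hder t ht').deriv]
    have e : conj (b - a) * (ψ' (a + t * (b - a)) * (b - a))
        = ((Complex.normSq (b - a) : ℝ) : ℂ) * ψ' (a + t * (b - a)) := by
      rw [Complex.normSq_eq_conj_mul_self]
      ring
    rw [e, Complex.re_ofReal_mul]
    exact mul_pos hnorm (hpos _ (hmem t ht'))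
  have := hmono (Set.left_mem_Icc.mpr zero_le_one) (Set.right_mem_Icc.mpr zero_le_one) one_pos
  simp [hab] at this

/-- Starlike functions are univalent. -/
theorem injOn_of_re_starQuot_pos {g : ℂ → ℂ} (hg : g ∈ ClassA)
    (hne : ∀ z ∈ ball (0 : ℂ) 1, z ≠ 0 → g z ≠ 0)
    (hpos : ∀ z ∈ ball (0 : ℂ) 1, 0 < (starQuot g z).re) : Set.InjOn g (ball 0 1) := by
  have hQ := differentiableOn_starQuot hg hne
  have hds : DifferentiableOn ℂ (dslope (starQuot g) 0) (ball 0 1) :=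
    (Complex.differentiableOn_dslope (ball_mem_nhds 0 one_pos)).mpr hQ
  -- H is a primitive of (zg'/g - 1)/z, so ζ + H(exp ζ) is, up to a constant, a logarithm of g(exp
  -- ζ) on the left half-plane. Its derivative zg'/g at z = exp ζ has positive real part, so it is
  -- injective.
  obtain ⟨H, hH⟩ := hds.isExactOn_ball
  set s : Set ℂ := {ζ | ζ.re < 0} with hs
  have hconv : Convex ℝ s := convex_halfSpace_re_lt 0
  have hopen : IsOpen s := isOpen_lt Complex.continuous_re continuous_const
  have hexp : ∀ ζ ∈ s, Complex.exp ζ ∈ ball (0 : ℂ) 1 := by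
    intro ζ hζ
    rw [mem_ball_zero_iff, Complex.norm_exp]
    exact Real.exp_lt_one_iff.mpr hζ
  set ψ : ℂ → ℂ := fun ζ => ζ + H (Complex.exp ζ) with hψ
  have hψd : ∀ ζ ∈ s, HasDerivAt ψ (starQuot g (Complex.exp ζ)) ζ := by
    intro ζ hζ
    have h1 := (hasDerivAt_id ζ).add ((hH _ (hexp ζ hζ)).comp ζ (Complex.hasDerivAt_exp ζ))
    refine HasDerivAt.congr_deriv (f := ψ) h1 ?_
    rw [dslope_of_ne _ (Complex.exp_ne_zero ζ), slope_def_field, starQuot_zero]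
    have := Complex.exp_ne_zero ζ
    field_simp
    ring
  have hinj : Set.InjOn ψ s :=
    hconv.injOn_of_re_deriv_pos hψd fun ζ hζ => hpos _ (hexp ζ hζ)
  have hE : ∀ ζ ∈ s, HasDerivAt (fun ζ => g (Complex.exp ζ) * Complex.exp (-ψ ζ)) 0 ζ := by
    intro ζ hζ
    have hz := hexp ζ hζ
    have h1 : HasDerivAt g (deriv g (Complex.exp ζ)) (Complex.exp ζ) :=
      (hg.1.differentiableAt (isOpen_ball.mem_nhds hz)).hasDerivAt
    have h2 := (h1.comp ζ (Complex.hasDerivAt_exp ζ)).mul (hψd ζ hζ).neg.cexp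
    refine h2.congr_deriv ?_
    have h3 := hne _ hz (Complex.exp_ne_zero ζ)
    rw [starQuot, quot1, if_neg (Complex.exp_ne_zero ζ)]
    simp only [Function.comp_apply, Pi.neg_apply]
    field_simp
    ring
  have hconst : ∀ a ∈ s, ∀ b ∈ s,
      g (Complex.exp a) * Complex.exp (-ψ a) = g (Complex.exp b) * Complex.exp (-ψ b) := by
    intro a ha b hb
    exact hopen.is_const_of_deriv_eq_zero hconv.isPreconnected
      (fun ζ hζ => (hE ζ hζ).differentiableAt.differentiableWithinAt)
      (fun ζ hζ => (hE ζ hζ).deriv) ha hb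
  have hlog : ∀ z ∈ ball (0 : ℂ) 1, z ≠ 0 → Complex.log z ∈ s := by
    intro z hz hz0
    rw [hs, Set.mem_ofPred_eq, Complex.log_re]
    exact Real.log_neg (norm_pos_iff.mpr hz0) (by simpa using hz)
  intro a ha b hb hab
  by_cases ha0 : a = 0
  · subst ha0
    by_contra hb0
    exact hne b hb (Ne.symm hb0) (by rw [← hab, hg.2.1])
  by_cases hb0 : b = 0
  · subst hb0
    exact absurd (by rw [hab, hg.2.1]) (hne a ha ha0)
  have hla := hlog a ha ha0
  have hlb := hlog b hb hb0
  have h1 := hconst _ hla _ hlb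
  rw [Complex.exp_log ha0, Complex.exp_log hb0, hab] at h1
  have h2 := mul_left_cancel₀ (hne b hb hb0) h1
  obtain ⟨n, hn⟩ := Complex.exp_eq_exp_iff_exists_int.mp h2
  -- Equal values of g give values of ψ differing by 2πin. Since ψ(ζ + 2πin) = ψ(ζ) + 2πin, a shift
  -- of the argument, harmless after exponentiation, absorbs the difference.
  have h3 : ψ (Complex.log b) = ψ (Complex.log a + n * (2 * Real.pi * Complex.I)) := by
    simp only [hψ]
    rw [Complex.exp_periodic.int_mul n]
    simp only [hψ] at hn
    linear_combination hn
  have h4 : Complex.log a + n * (2 * Real.pi * Complex.I) ∈ s := by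
    have e : (n : ℂ) * (2 * Real.pi * Complex.I)
        = ((n * (2 * Real.pi) : ℝ) : ℂ) * Complex.I := by push_cast; ring
    rw [hs, Set.mem_ofPred_eq, e, Complex.add_re, Complex.re_ofReal_mul, Complex.I_re, mul_zero,
      add_zero]
    exact hla
  have h5 := congrArg Complex.exp (hinj hlb h4 h3)
  rw [Complex.exp_periodic.int_mul n, Complex.exp_log ha0, Complex.exp_log hb0] at h5
  exact h5.symm

theorem mem_ClassS_of_mem_StarClass {g : ℂ → ℂ} (hg : g ∈ StarClass (phiOrder 0)) :
    g ∈ ClassS := by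
  obtain ⟨hA, hne, w, -, -, hw, heq⟩ := hg
  refine ⟨hA, injOn_of_re_starQuot_pos hA hne fun z hz => ?_⟩
  have h := re_one_add_div_one_sub_pos (hw z hz)
  rw [starQuot, heq z hz, phiOrder]
  simpa using h

/-- On the negative axis -`f3`(-t) = t(1-t)²/(1+t)³ peaks at t = 1/5, so every b in (1/5, r) shares
its value with some t ≤ 1/5. The peak comparison reduces to (5b-1)²(2-b) ≥ 0. -/
theorem dilate_f3_notMem_ClassS {r : ℝ} (hr : 1 / 5 < r) (hr1 : r ≤ 1) :
    dilate r f3 ∉ ClassS := by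
  rintro ⟨-, hinj⟩
  have hr0 : 0 < r := by linarith
  have hr' : (r : ℂ) ≠ 0 := by exact_mod_cast hr0.ne'
  set φ : ℝ → ℝ := fun t => t * (1 - t) ^ 2 / (1 + t) ^ 3 with hφ
  have hf3 : ∀ t : ℝ, f3 (-t : ℝ) = (-φ t : ℝ) := by
    intro t
    simp only [f3, hφ]
    push_cast
    ring
  obtain ⟨b, hb, hbr⟩ := exists_between hr
  have hle : φ b ≤ φ (1 / 5) := by
    simp only [hφ]
    rw [div_le_div_iff₀ (by positivity) (by norm_num)]
    nlinarith [mul_nonneg (sq_nonneg (5 * b - 1)) (by linarith : 0 ≤ 16 - 8 * b)]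
  have h0 : φ 0 ≤ φ b := by
    simp only [hφ]
    rw [zero_mul, zero_div]
    positivity
  have hcont : ContinuousOn φ (Set.Icc 0 (1 / 5)) := by
    refine ContinuousOn.div (by fun_prop) (by fun_prop) fun t ht => ?_
    have := ht.1
    positivity
  obtain ⟨t, ht, htb⟩ := intermediate_value_Icc (by norm_num) hcont ⟨h0, hle⟩
  have hmem : ∀ x : ℝ, 0 ≤ x → x < r → ((-x / r : ℝ) : ℂ) ∈ ball (0 : ℂ) 1 := by
    intro x hx hxr
    rw [mem_ball_zero_iff, Complex.norm_real, Real.norm_eq_abs, abs_div, abs_neg,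
      abs_of_nonneg hx, abs_of_pos hr0, div_lt_one hr0]
    exact hxr
  have hval : ∀ x : ℝ, dilate r f3 ((-x / r : ℝ) : ℂ) = (r : ℂ)⁻¹ * ((-φ x : ℝ) : ℂ) := by
    intro x
    rw [dilate, ← hf3, ← Complex.ofReal_mul, mul_div_cancel₀ _ hr0.ne']
  have heq := hinj (hmem t ht.1 (by linarith [ht.2])) (hmem b (by linarith) hbr)
    (by rw [hval, hval, htb])
  rw [Complex.ofReal_inj, div_left_inj' hr0.ne'] at heq
  linarith [ht.2]

theorem isSharpRadius_starlike :
    IsSharpRadius (StarClass (phiOrder 0)) ClassPi2 f3 (1 / 5) := by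
  have h := isSharpRadius_phiOrder (α := 0) le_rfl one_pos
  have e : (2 * (1 - 0) / (5 + √(4 * 0 ^ 2 - 4 * 0 + 25)) : ℝ) = 1 / 5 := by
    have : √(4 * 0 ^ 2 - 4 * 0 + 25 : ℝ) = 5 := by
      rw [show (4 * 0 ^ 2 - 4 * 0 + 25 : ℝ) = 5 ^ 2 by norm_num]
      exact Real.sqrt_sq (by norm_num)
    rw [this]
    norm_num
  rwa [e] at h

theorem isSharpRadius_univalence : IsSharpRadius ClassS ClassPi2 f3 (1 / 5) :=
  isSharpRadius_of_forall (by norm_num) (by norm_num) f3_mem_ClassPi2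
    (fun f hf r hr0 hr =>
      mem_ClassS_of_mem_StarClass (isSharpRadius_starlike.1.1.2.2 f hf r hr0 hr))
    fun _ hr hr1 => dilate_f3_notMem_ClassS hr hr1

theorem theorem2 :
    -- starlikeness of order `α`
    (∀ α : ℝ, 0 ≤ α → α < 1 →
      IsSharpRadius (StarClass (phiOrder α)) ClassPi2 f3
        (2 * (1 - α) / (5 + √(4 * α ^ 2 - 4 * α + 25)))) ∧
    -- lower bound for the class `𝒮*_L`
    (∃ R : ℝ, IsRadius (StarClass phiL) ClassPi2 R ∧
      (√(4 * √2 + 25) - 5) / (2 * (√2 + 2)) ≤ R) ∧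
    -- the class `𝒮_P`
    IsSharpRadius (StarClass phiP) ClassPi2 f3 (5 - 2 * √6) ∧
    -- the class `𝒮*_e`
    IsSharpRadius (StarClass phiE) ClassPi2 f3
      (2 * (Real.exp 1 - 1) /
        (5 * Real.exp 1 + √(25 * Real.exp 1 ^ 2 - 4 * Real.exp 1 + 4))) ∧
    -- the class `𝒮*_c`
    IsSharpRadius (StarClass phiC) ClassPi2 f3 ((15 - √217) / 2) ∧
    -- lower bound for the class `𝒮*_sin`
    (∃ R : ℝ, IsRadius (StarClass phiSin) ClassPi2 R ∧
      (√(25 + 4 * (3 + Real.sin 1) * Real.sin 1) - 5) / (2 * (3 + Real.sin 1)) ≤ R) ∧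
    -- the class `𝒮*_☾`
    IsSharpRadius (StarClass phiMoon) ClassPi2 f3
      ((5 - √(41 - 12 * √2)) / (2 * (√2 - 1))) ∧
    -- the class `𝒮*_R`
    IsSharpRadius (StarClass phiR) ClassPi2 f3
      ((5 - √(81 - 40 * √2)) / (4 * (√2 - 1))) ∧
    -- starlikeness and univalence
    IsSharpRadius (StarClass (phiOrder 0)) ClassPi2 f3 (1 / 5) ∧
    IsSharpRadius ClassS ClassPi2 f3 (1 / 5) :=
  ⟨fun _ h0 h1 => isSharpRadius_phiOrder h0 h1, exists_isRadius_phiL, isSharpRadius_phiP,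
    isSharpRadius_phiE, isSharpRadius_phiC, exists_isRadius_phiSin, isSharpRadius_phiMoon,
    isSharpRadius_phiR, isSharpRadius_starlike, isSharpRadius_univalence⟩
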